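/- Let $X$ be a geodesic metric space that is hyperbolic in the sense of Gromov, with Gromov boundary $\partial X$, and let a group $\Gamma$ act on $X$ by isometries. An element $h\in\Gamma$ is *loxodromic* if for some (equivalently, every) $x\in X$ the map $\mathbb Z\to X$, $k\mapsto h^k\cdot x$, is a quasi-isometric embedding; write $\partial_+h,\partial_-h\in\partial X$ for the limits of $h^kx$ as $k\to+\infty$ and $k\to-\infty$, and put $\partial h=\{\partial_-h,\partial_+h\}$, $\partial_\pm h=(\partial_-h,\partial_+h)$. Let $\mathrm{Stab}(\partial h)$ be the subgroup of $\Gamma$ preserving the set $\partial h$, and $\mathrm{Stab}(\partial_\pm h)$ the subgroup fixing both of its points. The action is *nonelementary* if there are loxodromic $g,h\in\Gamma$ with $\partial g\cap\partial h=\emptyset$. A loxodromic element $h$ is *WWPD* if for all $x\in X$ and $R>0$ there is an integer $M\ge 1$ such that every subset $Z\subset\Gamma$ with the following two properties is finite: $d(x,gx)<R$ and $d(h^Mx,gh^Mx)<R$ for all $g\in Z$; and no two distinct elements of $Z$ lie in the same left coset of $\mathrm{Stab}(\partial_\pm h)$. A *quasi-axis* of $h$ is a continuous quasi-isometric embedding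 $\ell:\mathbb R\to X$ such that, for some $T>0$, $h\,\ell(t)=\ell(t+T)$ for all $t$. Write $g\sim h$ if either $g=h$, or $g$ and $h$ are both loxodromic and, for some quasi-axes $\ell_g,\ell_h$ of $g,h$, there is $L$ such that for every segment $[a,b]\subset\mathbb R$ there are a segment $[c,d]\subset\mathbb R$ and $k\in\Gamma$ with $d(k\ell_g(a),\ell_h(c))\le L$, $d(k\ell_g(b),\ell_h(d))\le L$, and Hausdorff distance at most $L$ between $k(\ell_g[a,b])$ and $\ell_h[c,d]$. A subgroup $F\le\Gamma$ is *Schottky* if it is free of finite rank and for some (equivalently, every) $y\in X$ the orbit map $F\to X$, $f\mapsto f\cdot y$, is a quasi-isometric embedding with respect to the word metric of a free basis of $F$. **Proposition.** Suppose the action of $\Gamma$ on $X$ is nonelementary, let $\gamma\in\Gamma$ be WWPD, and let $\alpha\in\Gamma\setminus\mathrm{Stab}(\partial\gamma)$. Then there is an integer $A>0$ such that for every integer $a\ge A$, with $g_1=\gamma^a$ and $h_1=\gamma^a\alpha\gamma^{-a}\alpha^{-1}$: 1. $h_1$ is loxodromic; 2. $g_1\not\sim h_1$ and $g_1\not\sim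 h_1^{-1}$; 3. $g_1,h_1$ freely generate a Schottky subgroup of $\Gamma$, that is, $\langle g_1,h_1\rangle$ is free on the basis $g_1,h_1$ and is Schottky. -/

import Mathlib

open scoped Pointwise

namespace HyperbolicAction

/-! ### Gromov hyperbolic spaces and quasi-isometric embeddings -/

/-- A metric space in which any two points are joined by a geodesic segment. -/
class IsGeodesicSpace (X : Type*) [MetricSpace X] : Prop where
  exists_geodesic : ∀ x y : X, ∃ c : ℝ → X, c 0 = x ∧ c (dist x y) = y ∧
    ∀ s ∈ Set.Icc 0 (dist x y), ∀ t ∈ Set.Icc 0 (dist x y), dist (c s) (c t) = |s - t|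

/-- The Gromov product `(x | y)_w`. -/
noncomputable def gromovProduct {X : Type*} [MetricSpace X] (w x y : X) : ℝ :=
  (dist x w + dist y w - dist x y) / 2

/-- Gromov hyperbolicity (for some constant `δ`). -/
class IsGromovHyperbolic (X : Type*) [MetricSpace X] : Prop where
  exists_delta : ∃ δ : ℝ, ∀ w x y z : X,
    min (gromovProduct w x y) (gromovProduct w y z) - δ ≤ gromovProduct w x z

/-- `f` is a quasi-isometric embedding of `A`, equipped with the distance function `d`,
into the metric space `X`. -/
def IsQuasiIsometricEmbedding {A X : Type*} [MetricSpace X] (d : A → A → ℝ) (f : A → X) : Prop :=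
  ∃ K C : ℝ, 1 ≤ K ∧ 0 ≤ C ∧ ∀ a b : A,
    d a b / K - C ≤ dist (f a) (f b) ∧ dist (f a) (f b) ≤ K * d a b + C

/-! ### The Gromov boundary -/

section Boundary

variable {X : Type*} [MetricSpace X]

/-- `(u_i | v_j)_w → ∞` as `i, j → ∞`, for every base point `w`. -/
def GromovAsymptotic (u v : ℕ → X) : Prop :=
  ∀ w : X, Filter.Tendsto (fun p : ℕ × ℕ => gromovProduct w (u p.1) (v p.2))
    (Filter.atTop ×ˢ Filter.atTop) Filter.atTop

/-- A sequence converges at infinity if `(u_i | u_j)_w → ∞` as `i, j → ∞`. -/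
def ConvergesAtInfinity (u : ℕ → X) : Prop := GromovAsymptotic u u

theorem gromovProduct_comm (w x y : X) : gromovProduct w x y = gromovProduct w y x := by
  unfold gromovProduct
  rw [dist_comm x y]
  ring

theorem GromovAsymptotic.symm {u v : ℕ → X} (h : GromovAsymptotic u v) :
    GromovAsymptotic v u := by
  intro w
  have hs : Filter.Tendsto (Prod.swap : ℕ × ℕ → ℕ × ℕ)
      (Filter.atTop ×ˢ Filter.atTop) (Filter.atTop ×ˢ Filter.atTop) := Filter.tendsto_prod_swap
  refine ((h w).comp hs).congr ?_
  intro p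
  exact gromovProduct_comm w _ _

theorem GromovAsymptotic.trans [IsGromovHyperbolic X] {u v t : ℕ → X}
    (h1 : GromovAsymptotic u v) (h2 : GromovAsymptotic v t) : GromovAsymptotic u t := by
  obtain ⟨δ, hδ⟩ := IsGromovHyperbolic.exists_delta (X := X)
  intro w
  rw [Filter.tendsto_atTop]
  intro b
  have e1 := (Filter.tendsto_atTop.1 (h1 w)) (b + δ)
  have e2 := (Filter.tendsto_atTop.1 (h2 w)) (b + δ)
  rw [Filter.prod_atTop_atTop_eq, Filter.eventually_atTop] at e1 e2 ⊢
  obtain ⟨⟨a1, a2⟩, ha⟩ := e1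
  obtain ⟨⟨b1, b2⟩, hb⟩ := e2
  refine ⟨(a1, b2), ?_⟩
  rintro ⟨i, j⟩ ⟨hi, hj⟩
  have k1 := ha (i, max a2 b1) ⟨hi, le_max_left _ _⟩
  have k2 := hb (max a2 b1, j) ⟨le_max_right _ _, hj⟩
  have k3 := hδ w (u i) (v (max a2 b1)) (t j)
  have k4 := le_min k1 k2
  simp only at k4 ⊢
  linarith

variable (X) in
/-- The setoid of asymptotic sequences converging at infinity. -/
instance gromovSetoid [IsGromovHyperbolic X] :
    Setoid {u : ℕ → X // ConvergesAtInfinity u} where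
  r u v := GromovAsymptotic u.1 v.1
  iseqv := ⟨fun u => u.2, fun h => h.symm, fun h1 h2 => h1.trans h2⟩

variable (X) in
/-- The Gromov boundary of `X`: equivalence classes of sequences converging at infinity. -/
def GromovBoundary [IsGromovHyperbolic X] : Type _ := Quotient (gromovSetoid X)

theorem GromovAsymptotic.smul {Γ : Type*} [Group Γ] [MulAction Γ X] [IsIsometricSMul Γ X]
    (g : Γ) {u v : ℕ → X} (h : GromovAsymptotic u v) :
    GromovAsymptotic (fun n => g • u n) (fun n => g • v n) := by
  intro w
  refine (h (g⁻¹ • w)).congr ?_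
  intro p
  have e (x : X) : dist (g • x) w = dist x (g⁻¹ • w) := by
    rw [← dist_smul g x (g⁻¹ • w), smul_inv_smul]
  simp only [gromovProduct, e, dist_smul]

/-- The induced action of a group of isometries on the Gromov boundary. -/
instance boundaryAction {Γ : Type*} [Group Γ] [MulAction Γ X] [IsIsometricSMul Γ X]
    [IsGromovHyperbolic X] : MulAction Γ (GromovBoundary X) where
  smul g := Quotient.map (fun u => ⟨fun n => g • u.1 n, GromovAsymptotic.smul g u.2⟩)
    (fun _ _ h => GromovAsymptotic.smul g h)
  one_smul := by
    rintro ⟨u⟩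
    refine Quotient.sound ?_
    have e : (fun n => (1 : Γ) • u.1 n) = u.1 := by simp
    change GromovAsymptotic (fun n => (1 : Γ) • u.1 n) u.1
    rw [e]
    exact u.2
  mul_smul := by
    rintro g h ⟨u⟩
    refine Quotient.sound ?_
    have e : (fun n => (g * h) • u.1 n) = fun n => g • h • u.1 n := by
      simp [mul_smul]
    change GromovAsymptotic (fun n => (g * h) • u.1 n) (fun n => g • h • u.1 n)
    rw [e]
    exact GromovAsymptotic.smul g (GromovAsymptotic.smul h u.2)

end Boundary

/-! ### Loxodromic elements, their endpoints, and WWPD -/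

section Action

variable {Γ : Type*} [Group Γ] (X : Type*) [MetricSpace X] [MulAction Γ X]

/-- `h` is loxodromic: some (equivalently every) orbit map `k ↦ h ^ k • x`, `k ∈ ℤ`, is a
quasi-isometric embedding. -/
def IsLoxodromic (h : Γ) : Prop :=
  ∃ x : X, IsQuasiIsometricEmbedding (fun m n : ℤ => dist m n) (fun k : ℤ => h ^ k • x)

section Endpoints

variable [IsGromovHyperbolic X]

/-- The set of boundary points represented by the forward orbits `n ↦ h ^ n • x`.
If `h` is loxodromic this is the singleton consisting of the attracting point `∂₊ h`. -/
def attractor (h : Γ) : Set (GromovBoundary X) :=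
  {ξ | ∃ (x : X) (hx : ConvergesAtInfinity (fun n : ℕ => h ^ n • x)),
    ξ = Quotient.mk (gromovSetoid X) ⟨fun n : ℕ => h ^ n • x, hx⟩}

/-- For loxodromic `h`, the singleton consisting of the repelling point `∂₋ h`. -/
def repeller (h : Γ) : Set (GromovBoundary X) := attractor X h⁻¹

/-- For loxodromic `h`, the set `∂h = {∂₋ h, ∂₊ h}`. -/
def endpoints (h : Γ) : Set (GromovBoundary X) := repeller X h ∪ attractor X h

variable [IsIsometricSMul Γ X]

/-- The subgroup `Stab(∂h)` of elements preserving the unordered endpoint pair. -/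
def stabEndpoints (h : Γ) : Subgroup Γ := MulAction.stabilizer Γ (endpoints X h)

/-- The subgroup `Stab(∂± h)` of elements preserving the ordered pair `(∂₋ h, ∂₊ h)`. -/
def stabEndpointPair (h : Γ) : Subgroup Γ :=
  MulAction.stabilizer Γ (repeller X h) ⊓ MulAction.stabilizer Γ (attractor X h)

/-- `h` is WWPD: it is loxodromic and, for all `x` and `R > 0`, there is `M ≥ 1` such that every
set of group elements moving both `x` and `h ^ M • x` by less than `R`, and lying in pairwise
distinct left cosets of `Stab(∂± h)`, is finite. -/
def IsWWPD (h : Γ) : Prop :=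
  IsLoxodromic X h ∧
  ∀ (x : X) (R : ℝ), 0 < R → ∃ M : ℕ, 1 ≤ M ∧ ∀ Z : Set Γ,
    (∀ g ∈ Z, dist x (g • x) < R ∧ dist (h ^ M • x) (g • h ^ M • x) < R) →
    Set.InjOn (fun g : Γ => (g : Γ ⧸ stabEndpointPair X h)) Z →
    Z.Finite

variable (Γ) in
/-- The action is nonelementary: there are two independent loxodromic elements. -/
def IsNonelementary : Prop :=
  ∃ g h : Γ, IsLoxodromic X g ∧ IsLoxodromic X h ∧ Disjoint (endpoints X g) (endpoints X h)

end Endpoints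

/-! ### The equivalence relation on loxodromic elements -/

variable {X} in
/-- `ℓ` is a quasi-axis of `h`. -/
def IsQuasiAxis (h : Γ) (ℓ : ℝ → X) : Prop :=
  Continuous ℓ ∧ IsQuasiIsometricEmbedding (fun s t : ℝ => dist s t) ℓ ∧
    ∃ T : ℝ, 0 < T ∧ ∀ t : ℝ, h • ℓ t = ℓ (t + T)

/-- The relation `g ∼ h`: either `g = h`, or both are loxodromic and, for some quasi-axes and some
`L`, every subsegment of the quasi-axis of `g` has a translate that is `L`-Hausdorff close
rel endpoints to a subsegment of the quasi-axis of `h`. -/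
def Sim (g h : Γ) : Prop :=
  g = h ∨ (IsLoxodromic X g ∧ IsLoxodromic X h ∧
    ∃ ℓg ℓh : ℝ → X, IsQuasiAxis g ℓg ∧ IsQuasiAxis h ℓh ∧
      ∃ L : ℝ, ∀ a b : ℝ, a ≤ b → ∃ (c d : ℝ) (k : Γ), c ≤ d ∧
        dist (k • ℓg a) (ℓh c) ≤ L ∧ dist (k • ℓg b) (ℓh d) ≤ L ∧
        Metric.hausdorffDist (k • (ℓg '' Set.Icc a b)) (ℓh '' Set.Icc c d) ≤ L)

/-! ### Schottky subgroups -/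

/-- The subgroup `F` is Schottky: it is free of finite rank and, for some (equivalently every)
`y`, the orbit map `f ↦ f • y` is a quasi-isometric embedding for the word metric of a
free basis of `F`. -/
def IsSchottky (F : Subgroup Γ) : Prop :=
  ∃ (n : ℕ) (e : FreeGroup (Fin n) ≃* F) (y : X),
    IsQuasiIsometricEmbedding (fun u v : FreeGroup (Fin n) => ((u⁻¹ * v).norm : ℝ))
      (fun u => (e u : Γ) • y)

/-- `g` and `h` freely generate a Schottky subgroup. -/
def FreelyGenerateSchottky (g h : Γ) : Prop :=
  Function.Injective (FreeGroup.lift (![g, h] : Fin 2 → Γ)) ∧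
    IsSchottky X (Subgroup.closure {g, h})

end Action

end HyperbolicAction

/-!
The argument runs entirely in terms of Gromov products. Write `β = α * γ * α⁻¹` and
`h₁ = γ ^ a * (β ^ a)⁻¹`, and fix a base point `p`.

*Independence.* A WWPD element `γ` has the property that an isometry in the group fixing one of its
endpoints fixes the other (`IsWWPD.smul_repelling_of_fix`). Consequently an `α` that does not
preserve `∂γ` moves it off itself, so that the orbits of `γ` and `β` diverge: the products
`(γ ^ i p | β ^ j p)_p` are bounded over all integers `i, j`
(`IsWWPD.exists_gromovProduct_conj_le`).

*Ping-pong.* In a hyperbolic space a chain of points whose turns have bounded Gromov product and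
whose steps are long compared with that bound makes linear progress, and each of its vertices lies
coarsely between the ends (`IsLongChain.le_dist`, `IsLongChain.between`). The same principle,
applied to a power of a loxodromic element, shows that cyclic orbits are quasi-lines
(`IsLoxodromicAt.exists_between`). For large `a`, reduced words in `γ ^ a` and `β ^ a` trace such
chains, so these two elements freely generate a Schottky group; `γ ^ a` and `h₁` form another free
basis of it, and `h₁` is loxodromic.

*Non-equivalence.* The axis of `h₁` is a concatenation of translates of the segments from `p` to
`γ ^ a p` and from `p` to `(β ^ a)⁻¹ p`. If `γ ^ a ∼ h₁`, a translate by some `k` of the orbit of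
`γ` passes near `p`, coming from `γ ^ (-a) p` and going towards `(β ^ a)⁻¹ p`, with constants that
do not depend on `a` (`Follows.exists_turning`). If this happened for arbitrarily large `a`, then by
WWPD infinitely many of the translates would share their endpoints. The repelling one would be that
of `γ`, hence so would the attracting one, which contradicts the divergence of the orbits of `γ`
and `β` (`IsWWPD.not_turning`). The statement for `h₁⁻¹` is the same one for `α⁻¹`, because `h₁⁻¹`
is conjugate to the commutator formed with `α⁻¹`.
-/

namespace HyperbolicAction

/-! ### Gromov products -/

section GromovProduct

variable {X : Type*} [MetricSpace X]

theorem gromovProduct_nonneg (w x y : X) : 0 ≤ gromovProduct w x y := by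
  unfold gromovProduct
  have := dist_triangle_right x y w
  linarith

theorem gromovProduct_le_dist_left (w x y : X) : gromovProduct w x y ≤ dist x w := by
  unfold gromovProduct
  have := dist_triangle y x w
  rw [dist_comm y x] at this
  linarith

theorem gromovProduct_le_dist_right (w x y : X) : gromovProduct w x y ≤ dist y w := by
  rw [gromovProduct_comm]
  exact gromovProduct_le_dist_left w y x

theorem gromovProduct_add_swap (w x y : X) :
    gromovProduct w x y + gromovProduct x w y = dist x w := by
  unfold gromovProduct
  rw [dist_comm w x, dist_comm y w, dist_comm y x]
  ring

theorem gromovProduct_self_left (w y : X) : gromovProduct w w y = 0 := by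
  unfold gromovProduct
  rw [dist_self, dist_comm]
  ring

theorem gromovProduct_self_right (w y : X) : gromovProduct w y w = 0 := by
  rw [gromovProduct_comm, gromovProduct_self_left]

theorem dist_eq_sub_gromovProduct (w x y : X) :
    dist x y = dist x w + dist y w - 2 * gromovProduct w x y := by
  unfold gromovProduct
  ring

theorem gromovProduct_le_add_base (w w' x y : X) :
    gromovProduct w x y ≤ gromovProduct w' x y + dist w w' := by
  unfold gromovProduct
  have h1 := dist_triangle x w' w
  have h2 := dist_triangle y w' w
  rw [dist_comm w' w] at h1 h2
  linarith

theorem gromovProduct_le_add_left (w x x' y : X) :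
    gromovProduct w x y ≤ gromovProduct w x' y + dist x x' := by
  unfold gromovProduct
  have h1 := dist_triangle x x' w
  have h2 := dist_triangle x' x y
  rw [dist_comm x' x] at h2
  linarith

theorem gromovProduct_le_add_right (w x y y' : X) :
    gromovProduct w x y ≤ gromovProduct w x y' + dist y y' := by
  rw [gromovProduct_comm w x y, gromovProduct_comm w x y']
  exact gromovProduct_le_add_left w y y' x

theorem dist_sub_le_gromovProduct (w x y : X) :
    dist x w - dist x y ≤ gromovProduct w x y := by
  unfold gromovProduct
  have := dist_triangle x y w
  linarith

theorem dist_smul_left_eq {Γ : Type*} [Group Γ] [MulAction Γ X] [IsIsometricSMul Γ X]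
    (g : Γ) (x y : X) : dist (g • x) y = dist x (g⁻¹ • y) := by
  rw [← dist_smul g x (g⁻¹ • y), smul_inv_smul]

theorem gromovProduct_smul {Γ : Type*} [Group Γ] [MulAction Γ X] [IsIsometricSMul Γ X]
    (g : Γ) (w x y : X) :
    gromovProduct (g • w) (g • x) (g • y) = gromovProduct w x y := by
  simp only [gromovProduct, dist_smul]

theorem gromovProduct_smul_base {Γ : Type*} [Group Γ] [MulAction Γ X] [IsIsometricSMul Γ X]
    (g : Γ) (w x y : X) :
    gromovProduct (g • w) x y = gromovProduct w (g⁻¹ • x) (g⁻¹ • y) := by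
  rw [← gromovProduct_smul g⁻¹, inv_smul_smul]

variable (X) in
/-- `δ` is a hyperbolicity constant for the four-point condition on `X`. -/
def HyperbolicConst (δ : ℝ) : Prop :=
  ∀ w x y z : X,
    min (gromovProduct w x y) (gromovProduct w y z) - δ ≤ gromovProduct w x z

theorem HyperbolicConst.nonneg {δ : ℝ} (hδ : HyperbolicConst X δ) (p : X) : 0 ≤ δ := by
  have := hδ p p p p
  simp only [gromovProduct_self_left, min_self] at this
  linarith

theorem HyperbolicConst.le {δ : ℝ} (hδ : HyperbolicConst X δ) {w x y z : X} {b : ℝ}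
    (h1 : b ≤ gromovProduct w x y) (h2 : b ≤ gromovProduct w y z) :
    b - δ ≤ gromovProduct w x z := by
  have := hδ w x y z
  have := le_min h1 h2
  linarith

/-- If `(x | z)_w` is small and `(x | y)_w` is large, then `(y | z)_w` is small. -/
theorem HyperbolicConst.le_of_lt {δ : ℝ} (hδ : HyperbolicConst X δ) {w x y z : X} {b : ℝ}
    (h1 : gromovProduct w x z ≤ b) (h2 : b + δ < gromovProduct w x y) :
    gromovProduct w y z ≤ b + δ := by
  by_contra! h
  have h3 := hδ w x y z
  have h4 := lt_min h2 h
  linarith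

/-- Two points lying coarsely between `x` and `z`, at about the same distance from `x`,
are close to each other. -/
theorem HyperbolicConst.dist_le_of_between {δ : ℝ} (hδ : HyperbolicConst X δ) {x z u q : X}
    {C D : ℝ} (hu : gromovProduct u x z ≤ C) (hq : gromovProduct q x z ≤ C)
    (hd : |dist x u - dist x q| ≤ D) : dist u q ≤ D + 2 * C + 2 * δ := by
  have h1 := gromovProduct_add_swap x u z
  have h2 := gromovProduct_add_swap x q z
  rw [abs_le] at hd
  have h3 := dist_eq_sub_gromovProduct x u q
  rw [dist_comm u x] at h1 h3
  rw [dist_comm q x] at h2 h3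
  have h4 : min (dist x u) (dist x q) - C - δ ≤ gromovProduct x u q := by
    refine hδ.le (y := z) ?_ ?_
    · have := min_le_left (dist x u) (dist x q); linarith
    · rw [gromovProduct_comm x z q]
      have := min_le_right (dist x u) (dist x q); linarith
  rcases min_cases (dist x u) (dist x q) with ⟨h, _⟩ | ⟨h, _⟩ <;> rw [h] at h4 <;> linarith

end GromovProduct

/-! ### Chains with small turns and long steps -/

section Chain

variable {X : Type*} [MetricSpace X] {δ C : ℝ}

/-- A finite chain `x 0, …, x n` whose turns have Gromov product at most `C` and whose steps
are long compared with `C` and `δ`. -/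
structure IsLongChain (δ C : ℝ) (n : ℕ) (x : ℕ → X) : Prop where
  turn : ∀ i, i + 2 ≤ n → gromovProduct (x (i + 1)) (x i) (x (i + 2)) ≤ C
  step : ∀ i, i + 1 ≤ n → 2 * C + 3 * δ + 1 ≤ dist (x i) (x (i + 1))

theorem IsLongChain.mono {n m : ℕ} {x : ℕ → X} (h : IsLongChain δ C n x) (hm : m ≤ n) :
    IsLongChain δ C m x :=
  ⟨fun i hi => h.turn i (hi.trans hm), fun i hi => h.step i (hi.trans hm)⟩

theorem IsLongChain.reverse {n : ℕ} {x : ℕ → X} (h : IsLongChain δ C n x) :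
    IsLongChain δ C n (fun i => x (n - i)) := by
  refine ⟨fun i hi => ?_, fun i hi => ?_⟩
  · have := h.turn (n - (i + 2)) (by omega)
    rw [gromovProduct_comm]
    convert this using 3 <;> omega
  · have := h.step (n - (i + 1)) (by omega)
    rw [dist_comm]
    convert this using 3
    omega

/-- The turn bound persists when the incoming step is replaced by the segment from the start of the
chain. -/
theorem IsLongChain.turn_zero (hδ : HyperbolicConst X δ) {n : ℕ} {x : ℕ → X}
    (h : IsLongChain δ C n x) : ∀ i, i + 2 ≤ n →
      gromovProduct (x (i + 1)) (x 0) (x (i + 2)) ≤ C + δ := by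
  have hδ0 := hδ.nonneg (x 0)
  intro i
  induction i with
  | zero => intro hi; have := h.turn 0 hi; simp only [zero_add] at this ⊢; linarith
  | succ i ih =>
    intro hi
    have h1 := ih (by omega)
    have h2 := h.step (i + 1) (by omega)
    have h3 := gromovProduct_add_swap (x (i + 2)) (x (i + 1)) (x 0)
    rw [gromovProduct_comm (x (i + 1))] at h3
    exact hδ.le_of_lt (h.turn (i + 1) hi) (by linarith)

/-- A long chain progresses by at least one unit with every step. -/
theorem IsLongChain.le_dist (hδ : HyperbolicConst X δ) {n : ℕ} {x : ℕ → X}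
    (h : IsLongChain δ C n x) (hC : 0 ≤ C) : (n : ℝ) ≤ dist (x 0) (x n) := by
  have hδ0 := hδ.nonneg (x 0)
  induction n with
  | zero => simp
  | succ n ih =>
    have h1 := ih (h.mono (by omega))
    have h2 := h.step n le_rfl
    rcases n with _ | n
    · simp only [zero_add] at h2 ⊢; push_cast; linarith
    · have h3 := h.turn_zero hδ n le_rfl
      have h4 := dist_eq_sub_gromovProduct (x (n + 1)) (x 0) (x (n + 2))
      rw [dist_comm (x (n + 2))] at h4
      push_cast at h1 ⊢
      linarith

/-- Every vertex of a long chain lies coarsely between the two ends. -/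
theorem IsLongChain.between (hδ : HyperbolicConst X δ) {n j : ℕ} {x : ℕ → X}
    (h : IsLongChain δ C n x) (hC : 0 ≤ C) (hj : j ≤ n) :
    gromovProduct (x j) (x 0) (x n) ≤ C + 2 * δ := by
  have hδ0 := hδ.nonneg (x 0)
  rcases Nat.eq_zero_or_pos j with rfl | hj0
  · rw [gromovProduct_self_left]; linarith
  rcases hj.eq_or_lt with rfl | hjn
  · rw [gromovProduct_self_right]; linarith
  obtain ⟨i, rfl⟩ : ∃ i, j = i + 1 := ⟨j - 1, by omega⟩
  -- The chain read backwards from its end bounds the turn at `x j` towards `x (j - 1)`.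
  have h1 : gromovProduct (x (i + 1)) (x i) (x n) ≤ C + δ := by
    have := h.reverse.turn_zero hδ (n - (i + 2)) (by omega)
    rw [gromovProduct_comm] at this
    convert this using 3 <;> omega
  have h2 : dist (x i) (x (i + 1)) - C - δ ≤ gromovProduct (x (i + 1)) (x i) (x 0) := by
    rcases i with _ | i
    · have := dist_sub_le_gromovProduct (x (0 + 1)) (x 0) (x 0)
      rw [dist_self] at this; linarith
    · have h3 := h.turn_zero hδ i (by omega)
      have h4 := gromovProduct_add_swap (x (i + 2)) (x (i + 1)) (x 0)
      rw [gromovProduct_comm (x (i + 1))] at h4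
      linarith
  have h3 := h.step i (by omega)
  have := hδ.le_of_lt (y := x 0) h1 (by linarith)
  linarith

/-- The local-to-global principle for bi-infinite chains. -/
theorem between_of_longChain (hδ : HyperbolicConst X δ) (hC : 0 ≤ C) {x : ℤ → X}
    (turn : ∀ i, gromovProduct (x i) (x (i - 1)) (x (i + 1)) ≤ C)
    (step : ∀ i, 2 * C + 3 * δ + 1 ≤ dist (x i) (x (i + 1))) {i j k : ℤ} (hij : i ≤ j)
    (hjk : j ≤ k) :
    gromovProduct (x j) (x i) (x k) ≤ C + 2 * δ ∧ ((k - i : ℤ) : ℝ) ≤ dist (x i) (x k) := by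
  have hch : IsLongChain δ C (k - i).toNat (fun n : ℕ => x (i + n)) := by
    refine ⟨fun n _ => ?_, fun n _ => ?_⟩
    · have := turn (i + n + 1)
      convert this using 3 <;> push_cast <;> ring
    · have := step (i + n)
      convert this using 3
      push_cast; ring
  have e1 : i + ((k - i).toNat : ℤ) = k := by omega
  have e2 : i + ((j - i).toNat : ℤ) = j := by omega
  constructor
  · have := hch.between hδ hC (j := (j - i).toNat) (by omega)
    simpa only [e1, e2, Nat.cast_zero, add_zero] using this
  · have := hch.le_dist hδ hC
    simp only [e1, Nat.cast_zero, add_zero] at this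
    have e3 : (((k - i).toNat : ℕ) : ℝ) = ((k - i : ℤ) : ℝ) := by
      rw [← Int.cast_natCast, Int.toNat_of_nonneg (by omega)]
    linarith

end Chain

/-! ### Sequences converging at infinity -/

section Sequences

variable {X : Type*} [MetricSpace X]

theorem gromovAsymptotic_iff (w : X) {u v : ℕ → X} :
    GromovAsymptotic u v ↔
      ∀ b : ℝ, ∃ N : ℕ, ∀ i ≥ N, ∀ j ≥ N, b ≤ gromovProduct w (u i) (v j) := by
  constructor
  · intro h b
    have h1 := Filter.tendsto_atTop.1 (h w) b
    rw [Filter.prod_atTop_atTop_eq, Filter.eventually_atTop] at h1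
    obtain ⟨⟨a, c⟩, hac⟩ := h1
    exact ⟨max a c, fun i hi j hj =>
      hac (i, j) ⟨(le_max_left _ _).trans hi, (le_max_right _ _).trans hj⟩⟩
  · intro h w'
    rw [Filter.tendsto_atTop]
    intro b
    obtain ⟨N, hN⟩ := h (b + dist w w')
    rw [Filter.prod_atTop_atTop_eq, Filter.eventually_atTop]
    refine ⟨(N, N), ?_⟩
    rintro ⟨i, j⟩ ⟨hi, hj⟩
    have h1 := hN i hi j hj
    have h2 := gromovProduct_le_add_base w w' (u i) (v j)
    simp only
    linarith

/-- Sequences at bounded distance from each other are asymptotic if one converges. -/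
theorem GromovAsymptotic.of_dist_le {u v : ℕ → X} (hu : ConvergesAtInfinity u) {D : ℝ}
    (hD : ∀ n, dist (u n) (v n) ≤ D) : GromovAsymptotic u v := by
  rw [gromovAsymptotic_iff (u 0)]
  intro b
  obtain ⟨N, hN⟩ := (gromovAsymptotic_iff (u 0)).1 hu (b + D)
  refine ⟨N, fun i hi j hj => ?_⟩
  have h1 := hN i hi j hj
  have h2 := gromovProduct_le_add_right (u 0) (u i) (u j) (v j)
  have h3 := hD j
  linarith

/-- Sequences converging at infinity either have bounded mutual Gromov products or are
asymptotic. -/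
theorem GromovAsymptotic.of_unbounded {δ : ℝ} (hδ : HyperbolicConst X δ) {u v : ℕ → X}
    (hu : ConvergesAtInfinity u) (hv : ConvergesAtInfinity v) (w : X)
    (h : ∀ B : ℝ, ∃ i j, B ≤ gromovProduct w (u i) (v j)) : GromovAsymptotic u v := by
  rw [gromovAsymptotic_iff w]
  intro b
  obtain ⟨I, hI⟩ := (gromovAsymptotic_iff w).1 hu (b + 2 * δ)
  obtain ⟨J, hJ⟩ := (gromovAsymptotic_iff w).1 hv (b + 2 * δ)
  -- A large product forces large indices, because `(x | y)_w ≤ min (dist x w) (dist y w)`.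
  obtain ⟨i, j, hij⟩ := h (max (b + 2 * δ) (1 + (∑ i ∈ Finset.range I, dist (u i) w
    + ∑ j ∈ Finset.range J, dist (v j) w)))
  have hs1 : 0 ≤ ∑ i ∈ Finset.range I, dist (u i) w := Finset.sum_nonneg fun _ _ => dist_nonneg
  have hs2 : 0 ≤ ∑ j ∈ Finset.range J, dist (v j) w := Finset.sum_nonneg fun _ _ => dist_nonneg
  have hB := (le_max_right _ _).trans hij
  have hi : I ≤ i := by
    by_contra! hlt
    have h1 := Finset.single_le_sum (f := fun i => dist (u i) w) (fun _ _ => dist_nonneg)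
      (Finset.mem_range.2 hlt)
    have h2 := gromovProduct_le_dist_left w (u i) (v j)
    linarith
  have hj : J ≤ j := by
    by_contra! hlt
    have h1 := Finset.single_le_sum (f := fun i => dist (v i) w) (fun _ _ => dist_nonneg)
      (Finset.mem_range.2 hlt)
    have h2 := gromovProduct_le_dist_right w (u i) (v j)
    linarith
  refine ⟨max I J, fun i' hi' j' hj' => ?_⟩
  have h1 := hI i' ((le_max_left _ _).trans hi') i hi
  have h2 := hJ j hj j' ((le_max_right _ _).trans hj')
  have h3 := (le_max_left _ _).trans hij
  have h4 := hδ.le h1 h3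
  have h5 := hδ.le (w := w) (x := u i') (y := v j) (z := v j') (b := b + δ) (by linarith)
    (by have := hδ.nonneg w; linarith)
  linarith

/-- A lower bound on Gromov products with a fixed point, along a tail, passes to asymptotic
sequences. -/
theorem GromovAsymptotic.eventually_le {δ : ℝ} (hδ : HyperbolicConst X δ) {u v : ℕ → X}
    (huv : GromovAsymptotic u v) {w z : X} {b : ℝ}
    (h : ∃ J : ℕ, ∀ j ≥ J, b ≤ gromovProduct w (u j) z) :
    ∃ J : ℕ, ∀ j ≥ J, b - δ ≤ gromovProduct w (v j) z := by
  obtain ⟨J, hJ⟩ := h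
  obtain ⟨N, hN⟩ := (gromovAsymptotic_iff w).1 huv.symm b
  exact ⟨N, fun j hj => hδ.le (hN j hj (max J N) (le_max_right _ _)) (hJ _ (le_max_left _ _))⟩

theorem ConvergesAtInfinity.smul {Γ : Type*} [Group Γ] [MulAction Γ X] [IsIsometricSMul Γ X]
    (g : Γ) {u : ℕ → X} (hu : ConvergesAtInfinity u) :
    ConvergesAtInfinity (fun n => g • u n) := GromovAsymptotic.smul g hu

variable [IsGromovHyperbolic X]

/-- The boundary point represented by a sequence converging at infinity. -/
def boundaryMk (u : ℕ → X) (hu : ConvergesAtInfinity u) : GromovBoundary X :=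
  Quotient.mk (gromovSetoid X) ⟨u, hu⟩

theorem boundaryMk_eq_iff {u v : ℕ → X} {hu : ConvergesAtInfinity u}
    {hv : ConvergesAtInfinity v} : boundaryMk u hu = boundaryMk v hv ↔ GromovAsymptotic u v :=
  Quotient.eq

theorem exists_boundaryMk (ξ : GromovBoundary X) : ∃ u hu, ξ = boundaryMk u hu := by
  induction ξ using Quotient.inductionOn with
  | h u => exact ⟨u.1, u.2, rfl⟩

theorem smul_boundaryMk {Γ : Type*} [Group Γ] [MulAction Γ X] [IsIsometricSMul Γ X] (g : Γ)
    {u : ℕ → X} (hu : ConvergesAtInfinity u) :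
    g • boundaryMk u hu = boundaryMk (fun n => g • u n) (hu.smul g) := rfl

end Sequences

/-! ### Orbits of loxodromic elements -/

section Loxodromic

variable {Γ X : Type*} [Group Γ] [MetricSpace X] [MulAction Γ X]

/-- The orbit map of the cyclic group generated by `γ` at `p` is a quasi-isometric embedding. -/
def IsLoxodromicAt (γ : Γ) (p : X) : Prop :=
  IsQuasiIsometricEmbedding (fun m n : ℤ => dist m n) (fun k : ℤ => γ ^ k • p)

variable [IsIsometricSMul Γ X] {γ : Γ} {p : X}

theorem dist_zpow_smul (γ : Γ) (p : X) (i j : ℤ) :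
    dist (γ ^ i • p) (γ ^ j • p) = dist p (γ ^ (j - i) • p) := by
  rw [dist_smul_left_eq, smul_smul, ← zpow_neg, ← zpow_add, neg_add_eq_sub]

theorem dist_zpow_neg_smul (γ : Γ) (p : X) (i : ℤ) :
    dist p (γ ^ (-i) • p) = dist p (γ ^ i • p) := by
  have := dist_zpow_smul γ p i 0
  rw [zero_sub, zpow_zero, one_smul] at this
  rw [← this, dist_comm]

theorem dist_pow_smul_le (γ : Γ) (p : X) (n : ℕ) :
    dist p (γ ^ n • p) ≤ n * dist p (γ • p) := by
  induction n with
  | zero => simp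
  | succ n ih =>
    have h1 := dist_triangle p (γ ^ n • p) (γ ^ (n + 1) • p)
    rw [pow_succ, mul_smul, dist_smul] at h1
    rw [pow_succ, mul_smul]
    push_cast
    linarith

theorem dist_zpow_smul_le (γ : Γ) (p : X) (n : ℤ) :
    dist p (γ ^ n • p) ≤ |(n : ℝ)| * dist p (γ • p) := by
  have key : ∀ m : ℕ, dist p (γ ^ (m : ℤ) • p) ≤ |((m : ℤ) : ℝ)| * dist p (γ • p) := by
    intro m
    have := dist_pow_smul_le γ p m
    simpa using this
  obtain ⟨m, rfl | rfl⟩ := n.eq_nat_or_neg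
  · exact key m
  · rw [dist_zpow_neg_smul]
    have := key m
    push_cast at this ⊢
    rwa [abs_neg]

/-- A linear lower bound on displacements is enough for an element to be loxodromic. -/
theorem isLoxodromicAt_iff : IsLoxodromicAt γ p ↔
    ∃ K C : ℝ, 1 ≤ K ∧ 0 ≤ C ∧ ∀ n : ℤ, |(n : ℝ)| / K - C ≤ dist p (γ ^ n • p) := by
  constructor
  · rintro ⟨K, C, hK, hC, h⟩
    refine ⟨K, C, hK, hC, fun n => ?_⟩
    have := (h 0 n).1
    simpa [Int.dist_eq, abs_neg] using this
  · rintro ⟨K, C, hK, hC, h⟩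
    refine ⟨max K (dist p (γ • p)), C, le_max_of_le_left hK, hC, fun m n => ?_⟩
    have hK' : 0 < K := by linarith
    have e : dist m n = |((n - m : ℤ) : ℝ)| := by
      rw [Int.dist_eq, abs_sub_comm]; push_cast; rfl
    simp only [dist_zpow_smul, e]
    constructor
    · refine le_trans ?_ (h (n - m))
      gcongr
      exact le_max_left _ _
    · have h1 := dist_zpow_smul_le γ p (n - m)
      have h2 : |((n - m : ℤ) : ℝ)| * dist p (γ • p) ≤
          |((n - m : ℤ) : ℝ)| * max K (dist p (γ • p)) := by
        gcongr
        exact le_max_right _ _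
      linarith

theorem IsLoxodromicAt.inv (h : IsLoxodromicAt γ p) : IsLoxodromicAt γ⁻¹ p := by
  rw [isLoxodromicAt_iff] at h ⊢
  obtain ⟨K, C, hK, hC, h⟩ := h
  refine ⟨K, C, hK, hC, fun n => ?_⟩
  rw [inv_zpow, ← zpow_neg, dist_zpow_neg_smul]
  exact h n

theorem IsLoxodromicAt.conj (h : IsLoxodromicAt γ p) (α : Γ) :
    IsLoxodromicAt (α * γ * α⁻¹) (α • p) := by
  rw [isLoxodromicAt_iff] at h ⊢
  obtain ⟨K, C, hK, hC, h⟩ := h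
  refine ⟨K, C, hK, hC, fun n => ?_⟩
  rw [conj_zpow, smul_smul, inv_mul_cancel_right, mul_smul, dist_smul]
  exact h n

theorem IsLoxodromicAt.exists_lt_dist (h : IsLoxodromicAt γ p) (B : ℝ) :
    ∃ N : ℕ, ∀ n : ℤ, (N : ℤ) ≤ |n| → B ≤ dist p (γ ^ n • p) := by
  obtain ⟨K, C, hK, -, h⟩ := isLoxodromicAt_iff.1 h
  obtain ⟨N, hN⟩ := exists_nat_ge ((B + C) * K)
  refine ⟨N, fun n hn => ?_⟩
  have h1 : (N : ℝ) ≤ |(n : ℝ)| := by exact_mod_cast hn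
  have h2 : B + C ≤ |(n : ℝ)| / K := by
    rw [le_div_iff₀ (by linarith)]
    linarith
  linarith [h n]

/-- Displacements of powers grow linearly, so they cannot grow by a bounded amount
with every doubling of the exponent. -/
theorem IsLoxodromicAt.exists_doubling (h : IsLoxodromicAt γ p) (B : ℝ) :
    ∃ N : ℕ, 0 < N ∧ dist p (γ ^ N • p) + B ≤ dist p (γ ^ (2 * N) • p) := by
  obtain ⟨K, C, hK, -, h⟩ := isLoxodromicAt_iff.1 h
  by_contra! hcon
  have h1 : ∀ k : ℕ, dist p (γ ^ (2 ^ k) • p) ≤ dist p (γ • p) + k * B := by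
    intro k
    induction k with
    | zero => simp
    | succ k ih =>
      have := hcon (2 ^ k) (by positivity)
      rw [← pow_succ'] at this
      push_cast
      linarith
  have h2 : ∀ k : ℕ, (2 : ℝ) ^ k / K - C ≤ dist p (γ • p) + k * B := by
    intro k
    have h3 := h ((2 ^ k : ℕ) : ℤ)
    rw [zpow_natCast] at h3
    have e : |((((2 ^ k : ℕ) : ℤ)) : ℝ)| = 2 ^ k := by
      push_cast
      exact abs_of_nonneg (by positivity)
    rw [e] at h3
    exact h3.trans (h1 k)
  have t := tendsto_pow_const_div_const_pow_of_one_lt 1 (one_lt_two (α := ℝ))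
  have t0 := tendsto_pow_const_div_const_pow_of_one_lt 0 (one_lt_two (α := ℝ))
  have t2 := (t.mul_const (K * B)).add (t0.mul_const (K * (dist p (γ • p) + C)))
  simp only [zero_mul, add_zero, pow_one, pow_zero] at t2
  obtain ⟨k, hk⟩ := (t2.eventually (gt_mem_nhds (zero_lt_one' ℝ))).exists
  have h4 := h2 k
  have hK' : 0 < K := by linarith
  have hp : (0 : ℝ) < 2 ^ k := by positivity
  have h5 : (2 : ℝ) ^ k ≤ (dist p (γ • p) + k * B + C) * K := by
    rw [← div_le_iff₀ hK']; linarith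
  have h6 : (k * (K * B) + K * (dist p (γ • p) + C)) / (2 : ℝ) ^ k < 1 := by
    refine lt_of_eq_of_lt ?_ hk
    ring
  rw [div_lt_one hp] at h6
  linarith

theorem dist_zpow_smul_floor_le (γ : Γ) (p : X) {N : ℕ} (hN : 0 < N) (i : ℤ) :
    dist (γ ^ i • p) ((γ ^ N) ^ (i / N) • p) ≤ ∑ r ∈ Finset.range N, dist p (γ ^ r • p) := by
  have hN' : (0 : ℤ) < N := by exact_mod_cast hN
  have h1 := Int.emod_nonneg i hN'.ne'
  have h2 := Int.emod_lt_of_pos i hN'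
  have e : i - (N : ℤ) * (i / N) = ((i % N).toNat : ℤ) := by
    have := Int.mul_ediv_add_emod i N
    omega
  rw [← zpow_natCast, ← zpow_mul, dist_comm, dist_zpow_smul, e, zpow_natCast]
  exact Finset.single_le_sum (f := fun r : ℕ => dist p (γ ^ r • p))
    (fun _ _ => dist_nonneg) (Finset.mem_range.2 (by omega))

/-- The orbit of a loxodromic element is a quasi-line in the sense of Gromov products. A suitable
power moves `p` along a long chain; the remaining exponents are reached by a bounded move. -/
theorem IsLoxodromicAt.exists_between {δ : ℝ} (hδ : HyperbolicConst X δ)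
    (h : IsLoxodromicAt γ p) : ∃ C : ℝ, 0 ≤ C ∧ ∀ i j k : ℤ, i ≤ j → j ≤ k →
      gromovProduct (γ ^ j • p) (γ ^ i • p) (γ ^ k • p) ≤ C := by
  obtain ⟨N, hN, hd⟩ := h.exists_doubling (3 * δ + 1)
  set D := ∑ r ∈ Finset.range N, dist p (γ ^ r • p)
  have hD : 0 ≤ D := Finset.sum_nonneg fun _ _ => dist_nonneg
  set f := dist p (γ ^ N • p)
  have hδ0 := hδ.nonneg p
  set C := f - dist p (γ ^ (2 * N) • p) / 2 with hCdef
  have ed : ∀ i j : ℤ, dist ((γ ^ N) ^ i • p) ((γ ^ N) ^ j • p) =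
      dist p (γ ^ (N * (j - i)) • p) := by
    intro i j
    rw [dist_zpow_smul, ← zpow_natCast, ← zpow_mul]
  have e1 : ∀ i : ℤ, dist ((γ ^ N) ^ i • p) ((γ ^ N) ^ (i + 1) • p) = f := by
    intro i; rw [ed, add_sub_cancel_left, mul_one, zpow_natCast]
  have e2 : ∀ i : ℤ, gromovProduct ((γ ^ N) ^ i • p) ((γ ^ N) ^ (i - 1) • p)
      ((γ ^ N) ^ (i + 1) • p) = C := by
    intro i
    have h1 := e1 (i - 1)
    have h2 := e1 i
    have h3 := ed (i - 1) (i + 1)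
    rw [show (i + 1 - (i - 1) : ℤ) = (2 : ℕ) by push_cast; ring, ← Nat.cast_mul, zpow_natCast,
      mul_comm] at h3
    rw [sub_add_cancel] at h1
    unfold gromovProduct
    rw [h1, dist_comm ((γ ^ N) ^ (i + 1) • p), h2, h3, hCdef]
    ring
  have hC : 0 ≤ C := by rw [← e2 0]; exact gromovProduct_nonneg _ _ _
  refine ⟨C + 2 * δ + 3 * D, by linarith, fun i j k hij hjk => ?_⟩
  have hN' : (0 : ℤ) ≤ N := by omega
  have h1 := (between_of_longChain hδ hC (x := fun i : ℤ => (γ ^ N) ^ i • p)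
    (fun i => (e2 i).le) (fun i => by rw [e1]; linarith)
    (Int.ediv_le_ediv (by exact_mod_cast hN) hij : i / (N : ℤ) ≤ j / N)
    (Int.ediv_le_ediv (by exact_mod_cast hN) hjk : j / (N : ℤ) ≤ k / N)).1
  have h2 := dist_zpow_smul_floor_le γ p hN i
  have h3 := dist_zpow_smul_floor_le γ p hN j
  have h4 := dist_zpow_smul_floor_le γ p hN k
  have h5 := gromovProduct_le_add_base (γ ^ j • p) ((γ ^ N) ^ (j / N) • p) (γ ^ i • p) (γ ^ k • p)
  have h6 := gromovProduct_le_add_left ((γ ^ N) ^ (j / N) • p) (γ ^ i • p)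
    ((γ ^ N) ^ (i / N) • p) (γ ^ k • p)
  have h7 := gromovProduct_le_add_right ((γ ^ N) ^ (j / N) • p) ((γ ^ N) ^ (i / N) • p)
    (γ ^ k • p) ((γ ^ N) ^ (k / N) • p)
  linarith

theorem IsLoxodromicAt.convergesAtInfinity [IsGromovHyperbolic X] (h : IsLoxodromicAt γ p) :
    ConvergesAtInfinity (fun n : ℕ => γ ^ n • p) := by
  obtain ⟨δ, hδ⟩ := IsGromovHyperbolic.exists_delta (X := X)
  obtain ⟨C, -, hC⟩ := h.exists_between hδ
  unfold ConvergesAtInfinity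
  rw [gromovAsymptotic_iff p]
  intro b
  obtain ⟨N, hN⟩ := h.exists_lt_dist (b + C)
  have key : ∀ i j : ℕ, N ≤ i → i ≤ j → b ≤ gromovProduct p (γ ^ i • p) (γ ^ j • p) := by
    intro i j hi hij
    have h1 := hC 0 i j (by omega) (by omega)
    have h2 := hN i (by rw [abs_of_nonneg (by omega)]; omega)
    have h3 := gromovProduct_add_swap p (γ ^ i • p) (γ ^ j • p)
    rw [dist_comm] at h3
    simp only [zpow_natCast, zpow_zero, one_smul] at h1 h2
    linarith
  refine ⟨N, fun i hi j hj => ?_⟩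
  rcases le_total i j with hij | hij
  · exact key i j hi hij
  · rw [gromovProduct_comm]; exact key j i hj hij

variable [IsGromovHyperbolic X]

/-- The attracting fixed point of a loxodromic element; that of `γ⁻¹` is the repelling one. -/
def attractingPoint (h : IsLoxodromicAt γ p) : GromovBoundary X :=
  boundaryMk (fun n : ℕ => γ ^ n • p) h.convergesAtInfinity

theorem attractor_eq (h : IsLoxodromicAt γ p) : attractor X γ = {attractingPoint h} := by
  ext ξ
  constructor
  · rintro ⟨x, hx, rfl⟩
    refine boundaryMk_eq_iff.2 (GromovAsymptotic.of_dist_le hx (D := dist x p) fun n => ?_)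
    rw [dist_smul]
  · rintro rfl
    exact ⟨p, h.convergesAtInfinity, rfl⟩

theorem repeller_eq (h : IsLoxodromicAt γ p) : repeller X γ = {attractingPoint h.inv} :=
  attractor_eq h.inv

theorem smul_attractingPoint (h : IsLoxodromicAt γ p) :
    γ • attractingPoint h = attractingPoint h := by
  refine boundaryMk_eq_iff.2 (GromovAsymptotic.symm
    (GromovAsymptotic.of_dist_le h.convergesAtInfinity (D := dist p (γ • p)) fun n => ?_))
  rw [smul_smul, ← pow_succ', pow_succ, mul_smul, dist_smul]

theorem zpow_smul_attractingPoint (h : IsLoxodromicAt γ p) (k : ℤ) :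
    γ ^ k • attractingPoint h = attractingPoint h :=
  (MulAction.stabilizer Γ (attractingPoint h)).zpow_mem (smul_attractingPoint h) k

theorem zpow_smul_attractingPoint_inv (h : IsLoxodromicAt γ p) (k : ℤ) :
    γ ^ k • attractingPoint h.inv = attractingPoint h.inv := by
  have := zpow_smul_attractingPoint h.inv (-k)
  rwa [inv_zpow, zpow_neg, inv_inv] at this

theorem attractingPoint_ne (h : IsLoxodromicAt γ p) :
    attractingPoint h ≠ attractingPoint h.inv := by
  intro heq
  obtain ⟨δ, hδ⟩ := IsGromovHyperbolic.exists_delta (X := X)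
  obtain ⟨C, -, hC⟩ := h.exists_between hδ
  obtain ⟨N, hN⟩ := (gromovAsymptotic_iff p).1 (boundaryMk_eq_iff.1 heq) (C + 1)
  have h1 := hN N le_rfl N le_rfl
  have h2 := hC (-N) 0 N (by omega) (by omega)
  rw [gromovProduct_comm] at h2
  simp only [zpow_natCast, zpow_zero, one_smul, zpow_neg, inv_pow] at h1 h2
  linarith

/-- A positive power of a loxodromic element fixes only the two endpoints on the boundary. -/
theorem eq_attractingPoint_of_pow_smul (h : IsLoxodromicAt γ p) {l : ℕ} (hl : 0 < l)
    {ξ : GromovBoundary X} (hξ : γ ^ l • ξ = ξ) :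
    ξ = attractingPoint h ∨ ξ = attractingPoint h.inv := by
  obtain ⟨δ, hδ⟩ := IsGromovHyperbolic.exists_delta (X := X)
  obtain ⟨v, hv, rfl⟩ := exists_boundaryMk ξ
  by_contra! hcon
  -- Products of `v` with the backward orbit are bounded by some `B`.
  have hB : ∃ B, ∀ i j : ℕ, gromovProduct p (v i) (γ⁻¹ ^ j • p) < B := by
    by_contra! hB
    exact hcon.2 (boundaryMk_eq_iff.2
      (GromovAsymptotic.of_unbounded hδ hv h.inv.convergesAtInfinity p hB))
  obtain ⟨B, hB⟩ := hB
  -- Translating by powers that fix `ξ`, products of `v` with the forward orbit are unbounded.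
  refine hcon.1 (boundaryMk_eq_iff.2
    (GromovAsymptotic.of_unbounded hδ hv h.convergesAtInfinity p fun b => ?_))
  obtain ⟨N, hN⟩ := h.exists_lt_dist (b + B + δ)
  have hfix : γ ^ (l * N) • boundaryMk v hv = boundaryMk v hv := by
    rw [pow_mul]
    exact (MulAction.stabilizer Γ (boundaryMk v hv)).pow_mem hξ N
  rw [smul_boundaryMk, boundaryMk_eq_iff] at hfix
  have hd := hN (l * N : ℕ) (by
    rw [abs_of_nonneg (by omega)]
    exact_mod_cast Nat.le_mul_of_pos_left N hl)
  rw [zpow_natCast] at hd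
  obtain ⟨J, hJ⟩ := hfix.eventually_le hδ (w := p) (z := γ ^ (l * N) • p)
    (b := dist p (γ ^ (l * N) • p) - B) ⟨0, fun j _ => by
      have h1 := hB j (l * N)
      have h2 := gromovProduct_smul_base (γ ^ (l * N)) p (γ ^ (l * N) • v j) p
      rw [inv_smul_smul, ← inv_pow] at h2
      have h3 := gromovProduct_add_swap p (γ ^ (l * N) • p) (γ ^ (l * N) • v j)
      rw [gromovProduct_comm p, gromovProduct_comm (γ ^ (l * N) • p), h2, dist_comm] at h3
      linarith⟩
  refine ⟨J, l * N, ?_⟩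
  have := hJ J le_rfl
  linarith

end Loxodromic

/-! ### WWPD elements and their endpoints -/

section WWPD

variable {Γ X : Type*} [Group Γ] [MetricSpace X] [MulAction Γ X] [IsIsometricSMul Γ X]
  [IsGromovHyperbolic X] {γ : Γ} {p : X}

theorem attractingPoint_inv_inv (h : IsLoxodromicAt γ p) :
    attractingPoint h.inv.inv = attractingPoint h := by
  unfold attractingPoint
  congr 2
  rw [inv_inv]

theorem mem_stabEndpointPair_iff (h : IsLoxodromicAt γ p) {g : Γ} :
    g ∈ stabEndpointPair X γ ↔
      g • attractingPoint h = attractingPoint h ∧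
        g • attractingPoint h.inv = attractingPoint h.inv := by
  unfold stabEndpointPair
  rw [Subgroup.mem_inf, MulAction.mem_stabilizer_iff, MulAction.mem_stabilizer_iff,
    attractor_eq h, repeller_eq h, Set.smul_set_singleton, Set.smul_set_singleton,
    Set.singleton_eq_singleton_iff, Set.singleton_eq_singleton_iff, and_comm]

theorem stabEndpointPair_inv : stabEndpointPair X γ⁻¹ = stabEndpointPair X γ := by
  unfold stabEndpointPair repeller
  rw [inv_inv, inf_comm]

theorem stabEndpoints_inv : stabEndpoints X γ⁻¹ = stabEndpoints X γ := by
  unfold stabEndpoints endpoints repeller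
  rw [inv_inv, Set.union_comm]

theorem endpoints_eq (h : IsLoxodromicAt γ p) :
    endpoints X γ = {attractingPoint h.inv, attractingPoint h} := by
  unfold endpoints
  rw [attractor_eq h, repeller_eq h]
  rfl

theorem mem_stabEndpoints_of_swap (h : IsLoxodromicAt γ p) {g : Γ}
    (h1 : g • attractingPoint h = attractingPoint h.inv)
    (h2 : g • attractingPoint h.inv = attractingPoint h) : g ∈ stabEndpoints X γ := by
  unfold stabEndpoints
  rw [MulAction.mem_stabilizer_iff, endpoints_eq h, ← Set.image_smul, Set.image_pair, h1, h2,
    Set.pair_comm]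

theorem mem_stabEndpoints_of_fix (h : IsLoxodromicAt γ p) {g : Γ}
    (h1 : g • attractingPoint h = attractingPoint h)
    (h2 : g • attractingPoint h.inv = attractingPoint h.inv) : g ∈ stabEndpoints X γ := by
  unfold stabEndpoints
  rw [MulAction.mem_stabilizer_iff, endpoints_eq h, ← Set.image_smul, Set.image_pair, h1, h2]

theorem IsWWPD.exists_isLoxodromicAt (h : IsWWPD X γ) : ∃ p : X, IsLoxodromicAt γ p := h.1

theorem zpow_mem_stabEndpointPair (h : IsLoxodromicAt γ p) (k : ℤ) :
    γ ^ k ∈ stabEndpointPair X γ :=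
  (mem_stabEndpointPair_iff h).2
    ⟨zpow_smul_attractingPoint h k, zpow_smul_attractingPoint_inv h k⟩

/-- The inverse of a WWPD element is WWPD: conjugation by `γ ^ M` exchanges the displacement
conditions at `x`, `γ⁻¹ ^ M • x` and at `γ ^ M • x`, `x`. -/
theorem IsWWPD.inv (h : IsWWPD X γ) : IsWWPD X γ⁻¹ := by
  obtain ⟨p, hp⟩ := h.exists_isLoxodromicAt
  refine ⟨⟨p, hp.inv⟩, fun x R hR => ?_⟩
  obtain ⟨M, hM, hfin⟩ := h.2 x R hR
  refine ⟨M, hM, fun Z hZ hinj => ?_⟩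
  rw [stabEndpointPair_inv] at hinj
  have hcinj : Function.Injective (fun g : Γ => γ ^ M * g * (γ ^ M)⁻¹) := fun a b hab => by
    simpa using hab
  have hS : γ ^ M ∈ stabEndpointPair X γ := by
    simpa using zpow_mem_stabEndpointPair hp M
  refine Set.Finite.of_finite_image (f := fun g : Γ => γ ^ M * g * (γ ^ M)⁻¹)
    (hfin _ ?_ ?_) hcinj.injOn
  · rintro _ ⟨g, hg, rfl⟩
    obtain ⟨h1, h2⟩ := hZ g hg
    constructor
    · simp only [mul_smul]
      rw [dist_comm, dist_smul_left_eq, dist_comm, ← inv_pow]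
      exact h2
    · simp only [smul_smul, inv_mul_cancel_right]
      rw [mul_smul, dist_smul]
      exact h1
  · rintro _ ⟨g, hg, rfl⟩ _ ⟨g', hg', rfl⟩ heq
    congr 2
    refine hinj hg hg' ?_
    simp only [QuotientGroup.eq] at heq ⊢
    have e : (γ ^ M * g * (γ ^ M)⁻¹)⁻¹ * (γ ^ M * g' * (γ ^ M)⁻¹) =
      γ ^ M * (g⁻¹ * g') * (γ ^ M)⁻¹ := by group
    rw [e] at heq
    have := (stabEndpointPair X γ).mul_mem
      ((stabEndpointPair X γ).mul_mem ((stabEndpointPair X γ).inv_mem hS) heq) hS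
    convert this using 1
    group

/-- Sequential form of WWPD: elements that displace `p` and, eventually, each `γ ^ M • p`
by a bounded amount return infinitely often to a single coset of the pointwise stabilizer of
the endpoints. -/
theorem IsWWPD.exists_coset (h : IsWWPD X γ) {k : ℕ → Γ} {R : ℝ}
    (hk : ∀ M : ℕ, ∃ n₀, ∀ n ≥ n₀,
      dist p (k n • p) < R ∧ dist (γ ^ M • p) (k n • γ ^ M • p) < R) :
    ∃ g : Γ, ∀ n₀, ∃ n ≥ n₀, g⁻¹ * k n ∈ stabEndpointPair X γ := by
  have hR : 0 < R := by
    obtain ⟨n, hn⟩ := hk 0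
    exact dist_nonneg.trans_lt (hn n le_rfl).1
  obtain ⟨M, -, hfin⟩ := h.2 p R hR
  obtain ⟨m, hm⟩ := hk M
  set f : Γ → Γ ⧸ stabEndpointPair X γ := fun g => (g : Γ ⧸ stabEndpointPair X γ)
  set A : Set Γ := Set.range fun n => k (m + n)
  obtain ⟨Z, hZA, hZ⟩ := Set.exists_subset_bijOn A f
  have hZfin : Z.Finite := by
    refine hfin Z (fun g hg => ?_) hZ.injOn
    obtain ⟨n, rfl⟩ := hZA hg
    exact hm _ (by omega)
  have hfA : (f '' A).Finite := hZ.image_eq ▸ hZfin.image f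
  have : Finite (f '' A) := hfA
  obtain ⟨⟨_, g, hg, rfl⟩, hc⟩ := Finite.exists_infinite_fiber
    (fun n : ℕ => (⟨f (k (m + n)), k (m + n), ⟨n, rfl⟩, rfl⟩ : f '' A))
  refine ⟨g, fun n₀ => ?_⟩
  obtain ⟨n, hn, hlt⟩ := (Set.infinite_coe_iff.1 hc).exists_gt n₀
  refine ⟨m + n, by omega, ?_⟩
  have hn' : f (k (m + n)) = f g := congrArg Subtype.val hn
  exact QuotientGroup.eq.1 hn'.symm

/-- An isometry fixing the attracting point of `γ` moves the forward orbit a bounded amount. -/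
theorem exists_dist_le_of_fix (h : IsLoxodromicAt γ p) {g : Γ}
    (hg : g • attractingPoint h = attractingPoint h) :
    ∃ R, ∀ n : ℕ, dist (γ ^ n • p) (g • γ ^ n • p) ≤ R := by
  obtain ⟨δ, hδ⟩ := IsGromovHyperbolic.exists_delta (X := X)
  obtain ⟨C, -, hC⟩ := h.exists_between hδ
  have hδ0 := HyperbolicConst.nonneg hδ p
  refine ⟨3 * dist p (g • p) + 2 * C + 4 * δ, fun n => ?_⟩
  have hasy : GromovAsymptotic (fun n : ℕ => g • γ ^ n • p) (fun n : ℕ => γ ^ n • p) :=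
    boundaryMk_eq_iff.1 hg
  obtain ⟨N, hN⟩ := (gromovAsymptotic_iff p).1 hasy (dist p (γ ^ n • p))
  set m := max N n
  have h1 := hN m (le_max_left _ _) m (le_max_left _ _)
  have h2 := hC 0 n m (by omega) (by omega)
  simp only [zpow_natCast, zpow_zero, one_smul] at h2
  have h3 := gromovProduct_add_swap p (γ ^ n • p) (γ ^ m • p)
  have h4 := gromovProduct_le_add_base (g • p) p (g • γ ^ n • p) (g • γ ^ m • p)
  rw [gromovProduct_smul, dist_comm (g • p)] at h4
  rw [dist_comm _ p] at h3
  set d := dist p (γ ^ n • p)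
  have hD := dist_nonneg (x := p) (y := g • p)
  have hC0 : 0 ≤ C := (gromovProduct_nonneg _ _ _).trans h2
  have h5 := HyperbolicConst.le hδ (w := p) (x := g • γ ^ n • p) (y := g • γ ^ m • p)
    (z := γ ^ m • p) (b := d - C - dist p (g • p)) (by linarith) (by linarith)
  have h6 := HyperbolicConst.le hδ (z := γ ^ n • p) h5
    (by rw [gromovProduct_comm p]; linarith)
  have h7 := dist_eq_sub_gromovProduct p (g • γ ^ n • p) (γ ^ n • p)
  have h8 := dist_triangle (g • γ ^ n • p) (g • p) p
  rw [dist_smul, dist_comm (g • p) p, dist_comm (γ ^ n • p)] at h8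
  rw [dist_comm (γ ^ n • p) p] at h7
  rw [dist_comm (γ ^ n • p)]
  linarith

/-- An element fixing one endpoint of a WWPD element fixes both. The conjugates
`γ ^ (-n) * g * γ ^ n` displace the orbit boundedly, so two of them lie in one coset of the
stabilizer, and then a power of `γ` fixes the image of the other endpoint. -/
theorem IsWWPD.smul_repelling_of_fix (hw : IsWWPD X γ) (h : IsLoxodromicAt γ p) {g : Γ}
    (hg : g • attractingPoint h = attractingPoint h) :
    g • attractingPoint h.inv = attractingPoint h.inv := by
  obtain ⟨R, hR⟩ := exists_dist_le_of_fix h hg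
  have key : ∀ M n : ℕ, dist (γ ^ M • p) (((γ ^ n)⁻¹ * g * γ ^ n) • γ ^ M • p) < R + 1 := by
    intro M n
    have := hR (n + M)
    rw [pow_add, mul_smul] at this
    rw [mul_smul, mul_smul, dist_comm, dist_smul_left_eq, inv_inv, dist_comm]
    linarith
  obtain ⟨g₀, hg₀⟩ := hw.exists_coset (p := p) (k := fun n => (γ ^ n)⁻¹ * g * γ ^ n) (R := R + 1)
    fun M => ⟨0, fun n _ => ⟨by simpa using key 0 n, key M n⟩⟩
  obtain ⟨n, -, hn⟩ := hg₀ 0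
  obtain ⟨m, hm, hm'⟩ := hg₀ (n + 1)
  have fix : ∀ n : ℕ, g₀⁻¹ * ((γ ^ n)⁻¹ * g * γ ^ n) ∈ stabEndpointPair X γ →
      γ ^ n • g₀ • attractingPoint h.inv = g • attractingPoint h.inv := by
    intro n hn
    have h1 := ((mem_stabEndpointPair_iff h).1 hn).2
    have h2 := zpow_smul_attractingPoint_inv h n
    rw [zpow_natCast] at h2
    rw [mul_smul, mul_smul, mul_smul, h2, inv_smul_eq_iff, inv_smul_eq_iff] at h1
    exact h1.symm
  have h3 : γ ^ (m - n) • g • attractingPoint h.inv = g • attractingPoint h.inv := by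
    rw [← fix n hn, smul_smul, ← pow_add, Nat.sub_add_cancel (by omega), fix m hm', fix n hn]
  rcases eq_attractingPoint_of_pow_smul h (by omega) h3 with h4 | h4
  · rw [← hg] at h4
    exact absurd ((smul_left_cancel_iff g).1 h4).symm (attractingPoint_ne h)
  · exact h4

theorem IsWWPD.smul_attractingPoint_ne (hw : IsWWPD X γ) (h : IsLoxodromicAt γ p) {α : Γ}
    (hα : α ∉ stabEndpoints X γ) : α • attractingPoint h ≠ attractingPoint h := fun heq =>
  hα (mem_stabEndpoints_of_fix h heq (hw.smul_repelling_of_fix h heq))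

/-- If `α` moved the attracting point to the repelling one, the conjugate `α * γ * α⁻¹` would fix
an endpoint of `γ`, hence both, and `α` would exchange them. -/
theorem IsWWPD.smul_attractingPoint_ne_inv (hw : IsWWPD X γ) (h : IsLoxodromicAt γ p) {α : Γ}
    (hα : α ∉ stabEndpoints X γ) : α • attractingPoint h ≠ attractingPoint h.inv := by
  intro heq
  -- The conjugate `α * γ * α⁻¹` fixes the repelling point of `γ`, hence also the attracting one.
  have h1 : (α * γ * α⁻¹) • attractingPoint h.inv = attractingPoint h.inv := by
    rw [mul_smul, mul_smul, ← heq, inv_smul_smul, HyperbolicAction.smul_attractingPoint h]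
  have h2 := hw.inv.smul_repelling_of_fix h.inv h1
  rw [attractingPoint_inv_inv h, mul_smul, mul_smul, ← eq_inv_smul_iff] at h2
  rcases eq_attractingPoint_of_pow_smul h one_pos (by rwa [pow_one]) with h3 | h3
  · rw [inv_smul_eq_iff, heq] at h3
    exact attractingPoint_ne h h3
  · rw [inv_smul_eq_iff] at h3
    exact hα (mem_stabEndpoints_of_swap h heq h3.symm)

theorem exists_gromovProduct_le_of_ne {γ' : Γ} (h : IsLoxodromicAt γ p)
    (h' : IsLoxodromicAt γ' p) {α : Γ} (hne : α • attractingPoint h' ≠ attractingPoint h) :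
    ∃ B, ∀ i j : ℕ, gromovProduct p (γ ^ i • p) (α • γ' ^ j • p) ≤ B := by
  obtain ⟨δ, hδ⟩ := IsGromovHyperbolic.exists_delta (X := X)
  by_contra! hB
  refine hne (boundaryMk_eq_iff.2 (GromovAsymptotic.symm (GromovAsymptotic.of_unbounded hδ
    h.convergesAtInfinity (h'.convergesAtInfinity.smul α) p fun B => ?_)))
  obtain ⟨i, j, hij⟩ := hB B
  exact ⟨i, j, hij.le⟩

/-- A WWPD element `γ` and its conjugate by an element outside `Stab(∂γ)` are independent:
their orbits diverge uniformly. -/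
theorem IsWWPD.exists_gromovProduct_conj_le (hw : IsWWPD X γ) (h : IsLoxodromicAt γ p) {α : Γ}
    (hα : α ∉ stabEndpoints X γ) :
    ∃ B, ∀ i j : ℤ, gromovProduct p (γ ^ i • p) ((α * γ * α⁻¹) ^ j • p) ≤ B := by
  have hα' : α ∉ stabEndpoints X γ⁻¹ := by rwa [stabEndpoints_inv]
  obtain ⟨B₁, h₁⟩ := exists_gromovProduct_le_of_ne h h (hw.smul_attractingPoint_ne h hα)
  obtain ⟨B₂, h₂⟩ := exists_gromovProduct_le_of_ne h.inv h
    (hw.smul_attractingPoint_ne_inv h hα)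
  obtain ⟨B₃, h₃⟩ := exists_gromovProduct_le_of_ne h h.inv (by
    have := hw.inv.smul_attractingPoint_ne_inv h.inv hα'
    rwa [attractingPoint_inv_inv] at this)
  obtain ⟨B₄, h₄⟩ := exists_gromovProduct_le_of_ne h.inv h.inv
    (hw.inv.smul_attractingPoint_ne h.inv hα')
  refine ⟨max (max B₁ B₂) (max B₃ B₄) + dist (α⁻¹ • p) p, fun i j => ?_⟩
  have key := gromovProduct_le_add_right p (γ ^ i • p) ((α * γ * α⁻¹) ^ j • p) (α • γ ^ j • p)
  rw [conj_zpow, mul_smul, mul_smul, dist_smul, dist_smul] at key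
  rw [conj_zpow, mul_smul, mul_smul]
  have hmax : gromovProduct p (γ ^ i • p) (α • γ ^ j • p) ≤ max (max B₁ B₂) (max B₃ B₄) := by
    obtain ⟨i, rfl | rfl⟩ := i.eq_nat_or_neg <;> obtain ⟨j, rfl | rfl⟩ := j.eq_nat_or_neg
    · have := h₁ i j
      simp only [zpow_natCast, le_max_iff]; tauto
    · have := h₃ i j
      simp only [zpow_neg, zpow_natCast, inv_pow, le_max_iff] at this ⊢; tauto
    · have := h₂ i j
      simp only [zpow_neg, zpow_natCast, inv_pow, le_max_iff] at this ⊢; tauto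
    · have := h₄ i j
      simp only [zpow_neg, zpow_natCast, inv_pow, le_max_iff] at this ⊢; tauto
  linarith

end WWPD

/-! ### Ping-pong and Schottky subgroups -/

section AxisVertex

variable {Γ X : Type*} [Group Γ] [MulAction Γ X]

/-- The vertices of the axis of `b⁻¹ * x` through `p`: the orbit of `p` at even places and the
orbit of `b⁻¹ • p` at odd places. -/
def axisVertex (x b : Γ) (p : X) (n : ℤ) : X :=
  (b⁻¹ * x) ^ (n / 2) • if n % 2 = 0 then p else b⁻¹ • p

theorem axisVertex_even (x b : Γ) (p : X) (m : ℤ) :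
    axisVertex x b p (2 * m) = (b⁻¹ * x) ^ m • p := by
  have h1 : (2 * m) / 2 = m := by omega
  have h2 : (2 * m) % 2 = 0 := by omega
  simp [axisVertex, h1, h2]

theorem axisVertex_odd (x b : Γ) (p : X) (m : ℤ) :
    axisVertex x b p (2 * m + 1) = (b⁻¹ * x) ^ m • b⁻¹ • p := by
  have h1 : (2 * m + 1) / 2 = m := by omega
  have h2 : (2 * m + 1) % 2 = 1 := by omega
  simp [axisVertex, h1, h2]

theorem axisVertex_odd' (x b : Γ) (p : X) (m : ℤ) :
    axisVertex x b p (2 * m - 1) = (b⁻¹ * x) ^ m • x⁻¹ • p := by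
  have e : 2 * m - 1 = 2 * (m - 1) + 1 := by ring
  rw [e, axisVertex_odd, zpow_sub_one, mul_smul, smul_smul (_⁻¹), mul_inv_rev, inv_inv,
    mul_inv_cancel_right]

end AxisVertex

section PingPong

variable {Γ X ι : Type*} [Group Γ] [MetricSpace X] [MulAction Γ X]

/-- The group element denoted by a letter of a free group word. -/
def letter (f : ι → Γ) (l : ι × Bool) : Γ := cond l.2 (f l.1) (f l.1)⁻¹

/-- The elements `f i` and their inverses move `p` far away, in directions that diverge at
bounded distance from `p`. -/
structure IsPingPong (δ C : ℝ) (p : X) (f : ι → Γ) : Prop where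
  turn : ∀ l l' : ι × Bool, l ≠ l' → gromovProduct p (letter f l • p) (letter f l' • p) ≤ C
  step : ∀ l : ι × Bool, 2 * C + 3 * δ + 1 ≤ dist p (letter f l • p)

theorem letter_not (f : ι → Γ) (l : ι × Bool) : letter f (l.1, !l.2) = (letter f l)⁻¹ := by
  obtain ⟨i, _ | _⟩ := l <;> simp [letter]

variable [IsIsometricSMul Γ X] {δ C : ℝ} {p : X} {f : ι → Γ}

/-- Reduced words trace long chains, so they displace `p` at least by their length. -/
theorem IsPingPong.length_le_dist (hδ : HyperbolicConst X δ) (hC : 0 ≤ C)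
    (h : IsPingPong δ C p f) {L : List (ι × Bool)} (hL : FreeGroup.IsReduced L) :
    (L.length : ℝ) ≤ dist p ((L.map (letter f)).prod • p) := by
  have hsucc : ∀ i (hi : i < L.length), ((L.take (i + 1)).map (letter f)).prod =
      ((L.take i).map (letter f)).prod * letter f L[i] := by
    intro i hi
    rw [List.take_succ_eq_append_getElem hi, List.map_append, List.prod_append]
    simp
  have hch : IsLongChain δ C L.length (fun i => ((L.take i).map (letter f)).prod • p) := by
    refine ⟨fun i hi => ?_, fun i hi => ?_⟩
    · have h1 := hsucc i (by omega)
      have h2 := hsucc (i + 1) (by omega)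
      rw [h2, mul_smul, gromovProduct_smul_base, inv_smul_smul, h1, mul_inv_rev, mul_smul,
        inv_smul_smul, ← letter_not]
      refine h.turn _ _ fun heq => ?_
      have h3 := List.isChain_iff_getElem.1 hL i (by omega)
      rw [← heq] at h3
      simpa using h3 rfl
    · have h1 := hsucc i (by omega)
      rw [h1, mul_smul, dist_smul]
      exact h.step _
  have := hch.le_dist hδ hC
  simpa using this

theorem lift_eq_prod_letter (f : ι → Γ) [DecidableEq ι] (w : FreeGroup ι) :
    FreeGroup.lift f w = (w.toWord.map (letter f)).prod := by
  conv_lhs => rw [← FreeGroup.mk_toWord (x := w), FreeGroup.lift_mk]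
  rfl

theorem IsPingPong.norm_le_dist [DecidableEq ι] (hδ : HyperbolicConst X δ) (hC : 0 ≤ C)
    (h : IsPingPong δ C p f) (w : FreeGroup ι) :
    (w.norm : ℝ) ≤ dist p (FreeGroup.lift f w • p) := by
  rw [lift_eq_prod_letter]
  exact h.length_le_dist hδ hC FreeGroup.isReduced_toWord

theorem IsPingPong.injective (hδ : HyperbolicConst X δ) (hC : 0 ≤ C)
    (h : IsPingPong δ C p f) : Function.Injective (FreeGroup.lift f) := by
  classical
  refine (injective_iff_map_eq_one _).2 fun w hw => ?_
  have := h.norm_le_dist hδ hC w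
  rw [hw, one_smul, dist_self] at this
  exact FreeGroup.norm_eq_zero.1 (by exact_mod_cast le_antisymm this (Nat.cast_nonneg _))

theorem dist_lift_smul_le [DecidableEq ι] [Fintype ι] (f : ι → Γ) (p : X) (w : FreeGroup ι) :
    dist p (FreeGroup.lift f w • p) ≤ (∑ i, dist p (f i • p)) * w.norm := by
  rw [lift_eq_prod_letter, FreeGroup.norm]
  induction w.toWord with
  | nil => simp
  | cons l L ih =>
    have h1 : dist p (letter f l • p) ≤ ∑ i, dist p (f i • p) := by
      have h2 := Finset.single_le_sum (f := fun i => dist p (f i • p))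
        (fun _ _ => dist_nonneg) (Finset.mem_univ l.1)
      obtain ⟨i, _ | _⟩ := l
      · simp only [letter, cond_false]
        rwa [dist_comm, dist_smul_left_eq, inv_inv]
      · exact h2
    have h3 := dist_triangle p (letter f l • p) (letter f l • (L.map (letter f)).prod • p)
    rw [dist_smul] at h3
    rw [List.map_cons, List.prod_cons, mul_smul, List.length_cons]
    push_cast
    linarith

theorem IsPingPong.isSchottky_range {n : ℕ} {f : Fin n → Γ} (hδ : HyperbolicConst X δ)
    (hC : 0 ≤ C) (h : IsPingPong δ C p f) : IsSchottky X (FreeGroup.lift f).range := by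
  refine ⟨n, MonoidHom.ofInjective (h.injective hδ hC), p,
    max 1 (∑ i, dist p (f i • p)), 0, le_max_left _ _, le_rfl, fun u v => ?_⟩
  have e : dist (FreeGroup.lift f u • p) (FreeGroup.lift f v • p) =
      dist p (FreeGroup.lift f (u⁻¹ * v) • p) := by
    rw [dist_smul_left_eq, smul_smul, map_mul, map_inv]
  simp only [MonoidHom.ofInjective_apply, e, sub_zero, add_zero]
  constructor
  · refine le_trans (div_le_self (Nat.cast_nonneg _) (le_max_left _ _))
      (h.norm_le_dist hδ hC _)
  · refine (dist_lift_smul_le f p _).trans ?_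
    gcongr
    exact le_max_right _ _

/-- If `x, b` is a ping-pong pair, then `x, x * b⁻¹` is another free basis of the Schottky group
that `x, b` generate. -/
theorem IsPingPong.freelyGenerateSchottky {x b : Γ} (hδ : HyperbolicConst X δ) (hC : 0 ≤ C)
    (h : IsPingPong δ C p ![x, b]) : FreelyGenerateSchottky X x (x * b⁻¹) := by
  constructor
  · -- The automorphism `a₀ ↦ a₀`, `a₁ ↦ a₀ a₁⁻¹` of the free group and its inverse.
    set θ : FreeGroup (Fin 2) →* FreeGroup (Fin 2) :=
      FreeGroup.lift ![FreeGroup.of 0, FreeGroup.of 0 * (FreeGroup.of 1)⁻¹]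
    set θ' : FreeGroup (Fin 2) →* FreeGroup (Fin 2) :=
      FreeGroup.lift ![FreeGroup.of 0, (FreeGroup.of 1)⁻¹ * FreeGroup.of 0]
    have h1 : θ'.comp θ = MonoidHom.id _ := by
      ext i
      fin_cases i <;> simp [θ, θ']
    have h2 : FreeGroup.lift ![x, x * b⁻¹] = (FreeGroup.lift ![x, b]).comp θ := by
      ext i
      fin_cases i <;> simp [θ]
    rw [h2, MonoidHom.coe_comp]
    refine (h.injective hδ hC).comp (Function.LeftInverse.injective (g := θ') fun w => ?_)
    exact DFunLike.congr_fun h1 w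
  · have e : Subgroup.closure {x, x * b⁻¹} = (FreeGroup.lift ![x, b]).range := by
      rw [FreeGroup.range_lift_eq_closure, Matrix.range_cons, Matrix.range_cons,
        Matrix.range_empty, Set.union_empty, Set.singleton_union]
      apply le_antisymm
      · rw [Subgroup.closure_le]
        have hx : x ∈ Subgroup.closure {x, b} := Subgroup.subset_closure (by simp)
        have hb : b ∈ Subgroup.closure {x, b} := Subgroup.subset_closure (by simp)
        rintro _ (rfl | rfl)
        · exact hx
        · exact mul_mem hx (inv_mem hb)
      · rw [Subgroup.closure_le]
        have hx : x ∈ Subgroup.closure {x, x * b⁻¹} := Subgroup.subset_closure (by simp)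
        have hb : x * b⁻¹ ∈ Subgroup.closure {x, x * b⁻¹} := Subgroup.subset_closure (by simp)
        rintro _ (rfl | rfl)
        · exact hx
        · have := mul_mem (inv_mem hb) hx
          simpa using this
    rw [e]
    exact h.isSchottky_range hδ hC

theorem IsPingPong.axisVertex_between {x b : Γ} (hδ : HyperbolicConst X δ) (hC : 0 ≤ C)
    (h : IsPingPong δ C p ![x, b]) {i j k : ℤ} (hij : i ≤ j) (hjk : j ≤ k) :
    gromovProduct (axisVertex x b p j) (axisVertex x b p i) (axisVertex x b p k) ≤ C + 2 * δ ∧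
      ((k - i : ℤ) : ℝ) ≤ dist (axisVertex x b p i) (axisVertex x b p k) := by
  refine between_of_longChain hδ hC (fun n => ?_) (fun n => ?_) hij hjk
  · obtain ⟨m, rfl | rfl⟩ := n.even_or_odd'
    · rw [axisVertex_odd', axisVertex_even, axisVertex_odd, gromovProduct_smul]
      exact h.turn (0, false) (1, false) (by simp)
    · have e : 2 * m + 1 + 1 = 2 * (m + 1) := by ring
      rw [add_sub_cancel_right, e, axisVertex_even, axisVertex_even, axisVertex_odd, zpow_add_one,
        mul_smul, gromovProduct_smul, gromovProduct_smul_base, inv_inv, smul_smul,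
        mul_inv_cancel_left]
      exact h.turn (1, true) (0, true) (by simp)
  · obtain ⟨m, rfl | rfl⟩ := n.even_or_odd'
    · rw [axisVertex_even, axisVertex_odd, dist_smul]
      exact h.step (1, false)
    · have e : 2 * m + 1 + 1 = 2 * (m + 1) := by ring
      rw [e, axisVertex_even, axisVertex_odd, zpow_add_one, mul_smul, dist_smul, mul_smul,
        dist_smul]
      exact h.step (0, true)

theorem IsPingPong.isLoxodromicAt {x b : Γ} (hδ : HyperbolicConst X δ) (hC : 0 ≤ C)
    (h : IsPingPong δ C p ![x, b]) : IsLoxodromicAt (b⁻¹ * x) p := by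
  refine isLoxodromicAt_iff.2 ⟨1, 0, le_rfl, le_rfl, fun n => ?_⟩
  have key : ∀ m : ℕ, (m : ℝ) ≤ dist p ((b⁻¹ * x) ^ (m : ℤ) • p) := by
    intro m
    have h1 := (h.axisVertex_between hδ hC (i := 2 * 0) (j := 2 * 0) (k := 2 * (m : ℤ)) le_rfl
      (by omega)).2
    rw [axisVertex_even, axisVertex_even, zpow_zero, one_smul] at h1
    push_cast at h1
    linarith [Nat.cast_nonneg (α := ℝ) m]
  obtain ⟨m, rfl | rfl⟩ := n.eq_nat_or_neg
  · simpa using key m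
  · rw [dist_zpow_neg_smul]
    simpa using key m

end PingPong

section PowersPingPong

variable {Γ X : Type*} [Group Γ] [MetricSpace X] [MulAction Γ X] [IsIsometricSMul Γ X]
  {γ β : Γ} {p : X}

theorem IsLoxodromicAt.change_base (h : IsLoxodromicAt γ p) (q : X) : IsLoxodromicAt γ q := by
  rw [isLoxodromicAt_iff] at h ⊢
  obtain ⟨K, C, hK, hC, h⟩ := h
  refine ⟨K, C + 2 * dist p q, hK, by positivity, fun n => ?_⟩
  have h1 := h n
  have h2 := dist_triangle4 p q (γ ^ n • q) (γ ^ n • p)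
  rw [dist_smul, dist_comm q p] at h2
  linarith

/-- Large powers of loxodromic elements with uniformly diverging orbits play ping-pong. -/
theorem exists_isPingPong {δ B : ℝ} (hδ : HyperbolicConst X δ) (hγ : IsLoxodromicAt γ p)
    (hβ : IsLoxodromicAt β p)
    (hB : ∀ i j : ℤ, gromovProduct p (γ ^ i • p) (β ^ j • p) ≤ B) :
    ∃ C : ℝ, 0 ≤ C ∧ ∃ A : ℕ, ∀ a ≥ A, IsPingPong δ C p ![γ ^ a, β ^ a] := by
  obtain ⟨Cγ, hCγ0, hCγ⟩ := hγ.exists_between hδ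
  obtain ⟨Cβ, hCβ0, hCβ⟩ := hβ.exists_between hδ
  have hB0 : 0 ≤ B := (gromovProduct_nonneg _ _ _).trans (hB 0 0)
  set C := Cγ + Cβ + B
  obtain ⟨Nγ, hNγ⟩ := hγ.exists_lt_dist (2 * C + 3 * δ + 1)
  obtain ⟨Nβ, hNβ⟩ := hβ.exists_lt_dist (2 * C + 3 * δ + 1)
  refine ⟨C, by positivity, max Nγ Nβ, fun a ha => ?_⟩
  have ha1 : Nγ ≤ a := (le_max_left _ _).trans ha
  have ha2 : Nβ ≤ a := (le_max_right _ _).trans ha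
  have e : ∀ l : Fin 2 × Bool,
      letter ![γ ^ a, β ^ a] l = (![γ, β] l.1) ^ (cond l.2 (a : ℤ) (-a)) := by
    rintro ⟨i, _ | _⟩ <;> fin_cases i <;> simp [letter]
  have hγγ := hCγ (-a) 0 a (by omega) (by omega)
  have hββ := hCβ (-a) 0 a (by omega) (by omega)
  rw [zpow_zero, one_smul] at hγγ hββ
  constructor
  · rintro ⟨i, s⟩ ⟨i', s'⟩ hne
    rw [e, e]
    fin_cases i <;> fin_cases i'
    · cases s <;> cases s' <;> simp only [ne_eq, not_true_eq_false] at hne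
      · exact hγγ.trans (by simp only [C]; linarith)
      · exact (gromovProduct_comm _ _ _).trans_le (hγγ.trans (by simp only [C]; linarith))
    · exact (hB _ _).trans (by simp only [C]; linarith)
    · exact (gromovProduct_comm _ _ _).trans_le ((hB _ _).trans (by simp only [C]; linarith))
    · cases s <;> cases s' <;> simp only [ne_eq, not_true_eq_false] at hne
      · exact hββ.trans (by simp only [C]; linarith)
      · exact (gromovProduct_comm _ _ _).trans_le (hββ.trans (by simp only [C]; linarith))
  · rintro ⟨i, s⟩
    rw [e]
    fin_cases i
    · exact hNγ _ (by cases s <;> simp <;> omega)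
    · exact hNβ _ (by cases s <;> simp <;> omega)

end PowersPingPong

/-! ### Orbits that follow each other -/

theorem zpow_smul_quasiAxis {Γ X : Type*} [Group Γ] [MulAction Γ X] {h : Γ} {ℓ : ℝ → X} {T : ℝ}
    (hT : ∀ t, h • ℓ t = ℓ (t + T)) (m : ℤ) (t : ℝ) : h ^ m • ℓ t = ℓ (t + m * T) := by
  induction m using Int.induction_on generalizing t with
  | zero => simp
  | succ n ih =>
    rw [zpow_add_one, mul_smul, hT, ih]
    congr 1
    push_cast
    ring
  | pred n ih =>
    rw [zpow_sub_one, mul_smul]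
    have h1 : h⁻¹ • ℓ t = ℓ (t - T) := by
      rw [inv_smul_eq_iff, hT, sub_add_cancel]
    rw [h1, ih]
    congr 1
    push_cast
    ring

section Follows

variable {Γ X : Type*} [Group Γ] [MetricSpace X] [MulAction Γ X]

/-- Arbitrarily long forward segments of the `h`-orbit of `p` have endpoints uniformly close to
the endpoints of a translate of a forward segment of the `g`-orbit of `p`. -/
def Follows (p : X) (g h : Γ) : Prop :=
  ∃ L : ℝ, ∀ I : ℕ, ∃ (k : Γ) (n i : ℕ), I ≤ i ∧
    dist (k • p) p ≤ L ∧ dist (k • g ^ n • p) (h ^ i • p) ≤ L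

variable [IsIsometricSMul Γ X] {p : X} {g h : Γ}

theorem Follows.of_conj {x : Γ} (hf : Follows p g (x * h * x⁻¹)) : Follows p g h := by
  obtain ⟨L, hL⟩ := hf
  refine ⟨L + dist p (x⁻¹ • p), fun I => ?_⟩
  obtain ⟨k, n, i, hi, h1, h2⟩ := hL I
  refine ⟨x⁻¹ * k, n, i, hi, ?_, ?_⟩
  · have h3 := dist_triangle ((x⁻¹ * k) • p) (x⁻¹ • p) p
    rw [mul_smul, dist_smul, dist_comm (x⁻¹ • p)] at h3
    rw [mul_smul]
    linarith
  · rw [conj_pow, mul_smul, mul_smul] at h2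
    have h3 := dist_triangle ((x⁻¹ * k) • g ^ n • p) (h ^ i • x⁻¹ • p) (h ^ i • p)
    have h4 : dist ((x⁻¹ * k) • g ^ n • p) (h ^ i • x⁻¹ • p) =
        dist (k • g ^ n • p) (x • h ^ i • x⁻¹ • p) := by
      rw [mul_smul, dist_smul_left_eq, inv_inv]
    rw [dist_smul, h4, dist_comm (x⁻¹ • p)] at h3
    linarith

/-- Every point of a quasi-axis is uniformly close to the orbit point with the rounded index. -/
theorem exists_dist_quasiAxis_le {ℓ : ℝ → X}
    (hqi : IsQuasiIsometricEmbedding (fun s t : ℝ => dist s t) ℓ) {T : ℝ} (hT0 : 0 < T)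
    (hT : ∀ t, h • ℓ t = ℓ (t + T)) (p : X) :
    ∃ D, ∀ c, dist (ℓ c) (h ^ ⌊c / T⌋ • p) ≤ D := by
  obtain ⟨K, C, hK, hC, hKC⟩ := hqi
  refine ⟨K * T + C + dist (ℓ 0) p, fun c => ?_⟩
  have h1 : ℓ c = h ^ ⌊c / T⌋ • ℓ (c - ⌊c / T⌋ * T) := by
    rw [zpow_smul_quasiAxis hT, sub_add_cancel]
  have h2 : 0 ≤ c - ⌊c / T⌋ * T := by
    have := (le_div_iff₀ hT0).1 (Int.floor_le (c / T))
    linarith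
  have h3 : c - ⌊c / T⌋ * T ≤ T := by
    have := (div_lt_iff₀ hT0).1 (Int.lt_floor_add_one (c / T))
    linarith
  rw [h1, dist_smul]
  have h4 := (hKC (c - ⌊c / T⌋ * T) 0).2
  simp only [Real.dist_eq, sub_zero, abs_of_nonneg h2] at h4
  have h5 : K * (c - ⌊c / T⌋ * T) ≤ K * T := by gcongr
  have h6 := dist_triangle (ℓ (c - ⌊c / T⌋ * T)) (ℓ 0) p
  linarith

/-- Only the closeness of endpoints in the definition of `∼` is used. -/
theorem Sim.follows (hs : Sim X g h) (p : X) : Follows p g h := by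
  rcases hs with rfl | ⟨-, -, ℓg, ℓh, ⟨-, ⟨Kg, Cg, hKg, -, hqg⟩, Tg, hTg0, hTg⟩,
    ⟨-, hqh, Th, hTh0, hTh⟩, L, hL⟩
  · exact ⟨0, fun I => ⟨1, I, I, le_rfl, by simp, by simp⟩⟩
  obtain ⟨D, hD⟩ := exists_dist_quasiAxis_le hqh hTh0 hTh p
  obtain ⟨K, C, hK, hC, hqh⟩ := hqh
  refine ⟨dist p (ℓg 0) + L + D, fun I => ?_⟩
  -- With this `n` the endpoints on the axis of `h` are more than `I + 1` periods apart.
  obtain ⟨n, hn⟩ := exists_nat_gt ((K * ((I + 1) * Th) + C + 2 * L + Cg) * Kg / Tg)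
  obtain ⟨c, d, k, hcd, hc, hd, -⟩ := hL 0 (n * Tg) (by positivity)
  have e1 : ℓg (n * Tg) = g ^ n • ℓg 0 := by
    have := zpow_smul_quasiAxis hTg n 0
    rw [zpow_natCast] at this
    rw [this]
    push_cast
    rw [zero_add]
  have hfl : ⌊c / Th⌋ ≤ ⌊d / Th⌋ := by gcongr
  obtain ⟨i, hi⟩ := Int.eq_ofNat_of_zero_le (sub_nonneg.2 hfl)
  have hdc := dist_triangle4 (k • ℓg 0) (ℓh c) (ℓh d) (k • ℓg (n * Tg))
  rw [dist_smul, dist_comm (ℓh d)] at hdc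
  have hg := (hqg 0 (n * Tg)).1
  have hh := (hqh c d).2
  have hnT : 0 ≤ n * Tg := by positivity
  simp only [Real.dist_eq, zero_sub, abs_neg, abs_of_nonneg hnT] at hg
  simp only [Real.dist_eq, abs_sub_comm c d, abs_of_nonneg (sub_nonneg.2 hcd)] at hh
  refine ⟨(h ^ ⌊c / Th⌋)⁻¹ * k, n, i, ?_, ?_, ?_⟩
  · by_contra! hlt
    have h1 : (i : ℝ) ≤ I := by exact_mod_cast hlt.le
    have h2 := (div_lt_iff₀ hTh0).1 (Int.lt_floor_add_one (d / Th))
    have h3 := (le_div_iff₀ hTh0).1 (Int.floor_le (c / Th))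
    have h4 : (⌊d / Th⌋ : ℝ) = ⌊c / Th⌋ + i := by
      have : ⌊d / Th⌋ = ⌊c / Th⌋ + i := by omega
      exact_mod_cast this
    have h5 : d - c ≤ (I + 1) * Th := by
      rw [h4] at h2
      have : (i : ℝ) * Th ≤ I * Th := by gcongr
      linarith
    have h6 : K * (d - c) ≤ K * ((I + 1) * Th) := by gcongr
    rw [div_lt_iff₀ hTg0, ← lt_div_iff₀ (by linarith)] at hn
    linarith
  · rw [mul_smul, dist_smul_left_eq, inv_inv]
    have h1 := dist_triangle4 (k • p) (k • ℓg 0) (ℓh c) (h ^ ⌊c / Th⌋ • p)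
    rw [dist_smul] at h1
    have := hD c
    linarith
  · rw [mul_smul, dist_smul_left_eq, inv_inv, smul_smul (h ^ ⌊c / Th⌋),
      ← zpow_natCast h, ← zpow_add]
    have e2 : ⌊c / Th⌋ + (i : ℤ) = ⌊d / Th⌋ := by omega
    rw [e2]
    have h1 := dist_triangle4 (k • g ^ n • p) (k • ℓg (n * Tg)) (ℓh d) (h ^ ⌊d / Th⌋ • p)
    rw [dist_smul, e1, dist_smul] at h1
    rw [e1] at hd
    have := hD d
    linarith

end Follows

/-! ### Translates of the orbit of `γ` along the axis of `(β ^ a)⁻¹ * γ ^ a` -/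

section Turning

/-- Discrete intermediate value theorem for real sequences with increments at most `D`. -/
theorem exists_abs_sub_le_of_steps {f : ℕ → ℝ} {D E t : ℝ} {N : ℕ} (hD : 0 ≤ D) (hE : 0 ≤ E)
    (h0 : f 0 = 0) (hf : ∀ m, f (m + 1) ≤ f m + D) (ht : 0 ≤ t) (htN : t ≤ f N + E) :
    ∃ m ≤ N, |f m - t| ≤ D + E := by
  classical
  by_cases h : t ≤ f N
  · have hex : ∃ m, t ≤ f m := ⟨N, h⟩
    refine ⟨Nat.find hex, Nat.find_min' hex h, ?_⟩
    have h1 := Nat.find_spec hex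
    rcases hm : Nat.find hex with _ | m
    · rw [hm, h0] at h1
      rw [h0, abs_le]
      constructor <;> linarith
    · have h2 := Nat.find_min hex (m := m) (by omega)
      have h3 := hf m
      rw [hm] at h1
      rw [abs_le]
      constructor <;> linarith
  · exact ⟨N, le_rfl, by rw [abs_le]; constructor <;> linarith⟩

variable {Γ X : Type*} [Group Γ] [MetricSpace X] [MulAction Γ X] [IsIsometricSMul Γ X]
  {p : X} {δ : ℝ}

/-- If a translated ray of `σ` starting near `p` passes close to a far away point `w`, and `q`
lies coarsely between `p` and `w`, then the ray passes by `q`. -/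
theorem eventually_le_gromovProduct_of_dist_le (hδ : HyperbolicConst X δ) {σ k : Γ}
    {Cσ C C₁ L : ℝ} {m : ℕ} {w q : X}
    (hσ : ∀ j ≥ m, gromovProduct (σ ^ m • p) p (σ ^ j • p) ≤ Cσ) (hk : dist p (k • p) ≤ C₁)
    (hw : dist (k • σ ^ m • p) w ≤ L) (hq : gromovProduct q p w ≤ C) (hC : 0 ≤ C)
    (hfar : dist p q + L + 2 * C₁ + Cσ ≤ dist p w) :
    ∀ j ≥ m, dist p q - (C + 2 * δ) ≤ gromovProduct p (k • σ ^ j • p) q := by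
  intro j hj
  have hδ0 := hδ.nonneg p
  have hC₁ : 0 ≤ C₁ := dist_nonneg.trans hk
  have hCσ : 0 ≤ Cσ := (gromovProduct_nonneg _ _ _).trans (hσ j hj)
  -- `w` and `k • σ ^ m • p` are seen from `p` in the same direction as `q`.
  have h1 := dist_sub_le_gromovProduct p w (k • σ ^ m • p)
  rw [dist_comm w p, dist_comm w, gromovProduct_comm] at h1
  have h2 := gromovProduct_add_swap p q w
  rw [dist_comm q p, gromovProduct_comm p] at h2
  have h3 := hδ.le (w := p) (x := k • σ ^ m • p) (y := w) (z := q) (b := dist p q - C)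
    (by linarith) (by linarith)
  have h4 := gromovProduct_add_swap p (σ ^ m • p) (σ ^ j • p)
  have h5 := hσ j hj
  have h6 := gromovProduct_le_add_base (k • p) p (k • σ ^ m • p) (k • σ ^ j • p)
  rw [gromovProduct_smul, dist_comm (k • p)] at h6
  have h7 := dist_triangle4 p (k • p) (k • σ ^ m • p) w
  rw [dist_smul, dist_comm p (σ ^ m • p)] at h7
  have h8 := hδ.le (w := p) (x := k • σ ^ j • p) (y := k • σ ^ m • p) (z := q)
    (b := dist p q - C - δ) (by rw [gromovProduct_comm]; linarith) h3
  linarith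

/-- If the orbit of `γ` follows the axis of `b⁻¹ * γ ^ a`, then a translate of the orbit passes
through the vertex `p` of that axis, coming from `γ ^ (-a) • p` and going to `b⁻¹ • p`. The
constant does not depend on `a` and `b`. -/
theorem Follows.exists_turning {γ : Γ} {C Cγ : ℝ} (hδ : HyperbolicConst X δ) (hC : 0 ≤ C)
    (hγ : ∀ i j k : ℤ, i ≤ j → j ≤ k →
      gromovProduct (γ ^ j • p) (γ ^ i • p) (γ ^ k • p) ≤ Cγ) :
    ∃ R : ℝ, ∀ (a : ℕ) (b : Γ), IsPingPong δ C p ![γ ^ a, b] →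
      Follows p (γ ^ a) (b⁻¹ * γ ^ a) → ∃ k : Γ, dist p (k • p) ≤ R ∧ ∃ J : ℕ, ∀ j ≥ J,
        dist p (γ⁻¹ ^ a • p) - R ≤ gromovProduct p (k • γ⁻¹ ^ j • p) (γ⁻¹ ^ a • p) ∧
        dist p (b⁻¹ • p) - R ≤ gromovProduct p (k • γ ^ j • p) (b⁻¹ • p) := by
  have hδ0 := hδ.nonneg p
  have hCγ : 0 ≤ Cγ := (gromovProduct_nonneg _ _ _).trans (hγ 0 0 0 le_rfl le_rfl)
  have hstep := dist_nonneg (x := p) (y := γ • p)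
  set E := C + 4 * δ + Cγ with hE
  set C₁ := dist p (γ • p) + 4 * E + 2 * δ with hC₁
  refine ⟨C₁ + C + 4 * δ, fun a b hpp ⟨L, hL⟩ => ?_⟩
  have hL0 : 0 ≤ L := by
    obtain ⟨k, n, i, -, h, -⟩ := hL 0
    exact dist_nonneg.trans h
  have hda := dist_nonneg (x := p) (y := γ⁻¹ ^ a • p)
  have hdb := dist_nonneg (x := p) (y := b⁻¹ • p)
  obtain ⟨j, hj⟩ := exists_nat_gt
    (dist p (γ⁻¹ ^ a • p) + dist p (b⁻¹ • p) + L + 2 * C₁ + Cγ + C + 4 * δ + 1)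
  obtain ⟨k, n, i, hi, hk0, hkn⟩ := hL (2 * j)
  set h := b⁻¹ * γ ^ a
  have hij : j ≤ i := by omega
  have hj1 : 1 ≤ j := by
    by_contra! hj1
    obtain rfl : j = 0 := by omega
    push_cast at hj
    linarith
  -- The vertex `h ^ j • p` lies deep inside the segment from `p` to `h ^ i • p`.
  have hPZ : gromovProduct (h ^ j • p) p (h ^ i • p) ≤ C + 2 * δ := by
    have := (hpp.axisVertex_between hδ hC (i := 2 * 0) (j := 2 * (j : ℤ)) (k := 2 * (i : ℤ))
      (by omega) (by omega)).1
    simpa only [axisVertex_even, zpow_zero, one_smul, zpow_natCast] using this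
  have hfar1 : (j : ℝ) ≤ dist p (h ^ j • p) := by
    have := (hpp.axisVertex_between hδ hC (i := 2 * 0) (j := 2 * 0) (k := 2 * (j : ℤ))
      (by omega) (by omega)).2
    simp only [axisVertex_even, zpow_zero, one_smul, zpow_natCast] at this
    push_cast at this
    linarith [Nat.cast_nonneg (α := ℝ) j]
  have hfar2 : (j : ℝ) ≤ dist p (h ^ (i - j) • p) := by
    have := (hpp.axisVertex_between hδ hC (i := 2 * 0) (j := 2 * 0) (k := 2 * ((i - j : ℕ) : ℤ))
      (by omega) (by omega)).2
    simp only [axisVertex_even, zpow_zero, one_smul, zpow_natCast] at this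
    have h2 : (j : ℝ) ≤ ((i - j : ℕ) : ℝ) := by exact_mod_cast (by omega : j ≤ i - j)
    push_cast at this h2
    linarith [Nat.cast_nonneg (α := ℝ) j]
  have hqZ : dist (h ^ j • p) (h ^ i • p) = dist p (h ^ (i - j) • p) := by
    have := dist_zpow_smul h p j i
    rwa [← Nat.cast_sub hij, zpow_natCast, zpow_natCast, zpow_natCast] at this
  set q := h ^ j • p
  set x := k • p
  set z := k • (γ ^ a) ^ n • p
  have hxz : gromovProduct q x z ≤ C + 4 * δ := by
    have h1 := dist_sub_le_gromovProduct q p x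
    rw [dist_comm p x] at h1
    have h2 := hδ.le_of_lt (y := x) hPZ (by linarith)
    have h3 := dist_sub_le_gromovProduct q (h ^ i • p) z
    rw [dist_comm _ z, dist_comm _ q, hqZ] at h3
    rw [gromovProduct_comm] at h2
    have h4 := hδ.le_of_lt (y := z) h2 (by linarith)
    rw [gromovProduct_comm]
    linarith
  -- By discrete continuity the orbit passes close to `q`.
  obtain ⟨m, hmN, hm⟩ := exists_abs_sub_le_of_steps (f := fun m : ℕ => dist p (γ ^ m • p))
    (D := dist p (γ • p)) (E := 2 * E) (t := dist x q) (N := a * n) hstep (by positivity)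
    (by simp) (fun m => by
      have := dist_triangle p (γ ^ m • p) (γ ^ (m + 1) • p)
      rw [pow_succ, mul_smul] at this ⊢
      rwa [dist_smul] at this) dist_nonneg (by
      have h1 := dist_eq_sub_gromovProduct q x z
      have h2 : dist x z = dist p (γ ^ (a * n) • p) := by rw [dist_smul, ← pow_mul]
      rw [h2] at h1
      have := dist_nonneg (x := z) (y := q)
      linarith)
  have hxu : gromovProduct (k • γ ^ m • p) x z ≤ E := by
    have := hγ 0 m (a * n : ℕ) (by omega) (by omega)
    simp only [zpow_natCast, zpow_zero, one_smul] at this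
    rw [gromovProduct_smul, ← pow_mul]
    linarith
  have huq := hδ.dist_le_of_between (D := dist p (γ • p) + 2 * E) hxu
    (hxz.trans (by linarith)) (by rwa [dist_smul])
  -- Translating by `h ^ (-j)` moves `q` to `p`.
  have hk' : dist p (((h ^ j)⁻¹ * k * γ ^ m) • p) ≤ C₁ := by
    rw [mul_smul, mul_smul, dist_comm, dist_smul_left_eq, inv_inv]
    linarith
  have hC₁0 := dist_nonneg.trans hk'
  refine ⟨(h ^ j)⁻¹ * k * γ ^ m, by linarith, max m (a * n - m), fun j' hj' => ⟨?_, ?_⟩⟩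
  · have hback : gromovProduct (γ⁻¹ ^ a • p) p ((h ^ j)⁻¹ • p) ≤ C + 2 * δ := by
      have := (hpp.axisVertex_between hδ hC (i := 2 * (-j : ℤ)) (j := 2 * 0 - 1) (k := 2 * 0)
        (by omega) (by omega)).1
      simp only [axisVertex_even, axisVertex_odd', zpow_zero, one_smul, zpow_neg,
        zpow_natCast] at this
      rwa [gromovProduct_comm, inv_pow]
    have := eventually_le_gromovProduct_of_dist_le (p := p) hδ (σ := γ⁻¹)
      (k := (h ^ j)⁻¹ * k * γ ^ m) (Cσ := Cγ) (L := L) (m := m) (fun j hj => by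
        have := hγ (-j) (-m) 0 (by omega) (by omega)
        rw [gromovProduct_comm]
        simpa only [zpow_neg, zpow_natCast, inv_pow, zpow_zero, one_smul] using this)
      hk' (by
        rw [mul_smul, inv_pow, smul_inv_smul, mul_smul, dist_smul]
        exact hk0) hback (by linarith) (by
        have : dist p ((h ^ j)⁻¹ • p) = dist p (h ^ j • p) := by
          rw [dist_comm, dist_smul_left_eq, inv_inv]
        rw [this]
        linarith) j' ((le_max_left _ _).trans hj')
    linarith
  · have hforw : gromovProduct (b⁻¹ • p) p (h ^ (i - j) • p) ≤ C + 2 * δ := by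
      have := (hpp.axisVertex_between hδ hC (i := 2 * 0) (j := 2 * 0 + 1)
        (k := 2 * ((i - j : ℕ) : ℤ)) (by omega) (by omega)).1
      simpa only [axisVertex_even, axisVertex_odd, zpow_zero, one_smul, zpow_natCast] using this
    have := eventually_le_gromovProduct_of_dist_le (p := p) hδ (σ := γ)
      (k := (h ^ j)⁻¹ * k * γ ^ m) (Cσ := Cγ) (L := L) (m := a * n - m) (fun j hj => by
        have := hγ 0 (a * n - m : ℕ) j (by omega) (by omega)
        simpa only [zpow_natCast, zpow_zero, one_smul] using this)
      hk' (by
        have e : h ^ i = h ^ j * h ^ (i - j) := by rw [← pow_add, Nat.add_sub_cancel' hij]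
        rw [mul_smul _ (γ ^ m), smul_smul (γ ^ m), ← pow_add, Nat.add_sub_cancel' hmN, mul_smul,
          dist_smul_left_eq, inv_inv, smul_smul (h ^ j), ← e, pow_mul]
        exact hkn) hforw (by linarith) (by linarith) j' ((le_max_right _ _).trans hj')
    linarith

/-- A translate of the orbit of `σ` that starts near `p` and passes by `σ ^ a • p` fellow travels
the orbit up to time `a`. -/
theorem dist_le_of_fellow {σ : Γ} {Cσ : ℝ} (hδ : HyperbolicConst X δ)
    (hσ : ∀ i j : ℕ, i ≤ j → gromovProduct (σ ^ i • p) p (σ ^ j • p) ≤ Cσ) {k : Γ} {R : ℝ}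
    {a M J : ℕ} (hM : M ≤ a) (hk : dist p (k • p) ≤ R)
    (hJ : ∀ j ≥ J, dist p (σ ^ a • p) - R ≤ gromovProduct p (k • σ ^ j • p) (σ ^ a • p)) :
    dist (σ ^ M • p) (k • σ ^ M • p) ≤ 5 * R + 2 * Cσ + 4 * δ := by
  have hδ0 := hδ.nonneg p
  have hR := dist_nonneg.trans hk
  have hCσ := (gromovProduct_nonneg _ _ _).trans (hσ 0 0 le_rfl)
  have h1 := hσ M a hM
  have h2 := hσ M (max M J) (le_max_left _ _)
  have h3 := hJ (max M J) (le_max_right _ _)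
  have h4 := gromovProduct_add_swap p (σ ^ M • p) (σ ^ a • p)
  have h5 := gromovProduct_add_swap p (σ ^ M • p) (σ ^ max M J • p)
  have h6 := gromovProduct_le_dist_right p (σ ^ M • p) (σ ^ a • p)
  have h7 := gromovProduct_le_add_base (k • p) p (k • σ ^ M • p) (k • σ ^ max M J • p)
  rw [gromovProduct_smul, dist_comm (k • p)] at h7
  rw [dist_comm _ p] at h4 h5 h6
  set d := dist p (σ ^ M • p)
  have h8 := hδ.le (w := p) (x := k • σ ^ M • p) (y := k • σ ^ max M J • p) (z := σ ^ a • p)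
    (b := d - Cσ - R) (by linarith) (by linarith)
  have h9 := hδ.le (w := p) (z := σ ^ M • p) h8 (by rw [gromovProduct_comm]; linarith)
  have h10 := dist_eq_sub_gromovProduct p (k • σ ^ M • p) (σ ^ M • p)
  have h11 := dist_triangle p (k • p) (k • σ ^ M • p)
  rw [dist_smul] at h11
  rw [dist_comm (k • σ ^ M • p) p, dist_comm (σ ^ M • p) p] at h10
  rw [dist_comm]
  linarith

end Turning

/-! ### Non-equivalence -/

section Conclusion

variable {Γ X : Type*} [Group Γ] [MetricSpace X] [MulAction Γ X] [IsIsometricSMul Γ X]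
  [IsGromovHyperbolic X] {γ : Γ} {p : X}

/-- Translates `k n` of the orbit of a WWPD element `γ` cannot pass near `p` while coming from
`γ ^ (-a n) • p` and going to `(β ^ a n)⁻¹ • p`, for `a n` unbounded: by WWPD infinitely many of
them would have the same endpoints, the repelling one being that of `γ`; hence the attracting one
would also be that of `γ`, although it lies in the direction of the `β`-orbit. -/
theorem IsWWPD.not_turning {β : Γ} (hw : IsWWPD X γ) (hγ : IsLoxodromicAt γ p)
    (hβ : IsLoxodromicAt β p) {B : ℝ}
    (hB : ∀ i j : ℤ, gromovProduct p (γ ^ i • p) (β ^ j • p) ≤ B) {R : ℝ} {a : ℕ → ℕ}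
    (ha : ∀ n, n ≤ a n) {k : ℕ → Γ} (hk : ∀ n, dist p (k n • p) ≤ R)
    (hturn : ∀ n, ∃ J : ℕ, ∀ j ≥ J,
      dist p (γ⁻¹ ^ a n • p) - R ≤ gromovProduct p (k n • γ⁻¹ ^ j • p) (γ⁻¹ ^ a n • p) ∧
      dist p ((β ^ a n)⁻¹ • p) - R ≤ gromovProduct p (k n • γ ^ j • p) ((β ^ a n)⁻¹ • p)) :
    False := by
  obtain ⟨δ, hδ⟩ := IsGromovHyperbolic.exists_delta (X := X)
  have hδ0 := HyperbolicConst.nonneg hδ p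
  obtain ⟨C, hC0, hC⟩ := hγ.inv.exists_between hδ
  have hR := dist_nonneg.trans (hk 0)
  have hfellow : ∀ M n : ℕ, M ≤ n →
      dist (γ⁻¹ ^ M • p) (k n • γ⁻¹ ^ M • p) ≤ 5 * R + 2 * C + 4 * δ := by
    intro M n hMn
    obtain ⟨J, hJ⟩ := hturn n
    refine dist_le_of_fellow hδ (fun i j hij => ?_) (hMn.trans (ha n)) (hk n)
      fun j hj => (hJ j hj).1
    have := hC 0 i j (by omega) (by omega)
    simpa only [zpow_natCast, zpow_zero, one_smul] using this
  obtain ⟨g, hg⟩ := hw.inv.exists_coset (p := p) (k := k) (R := 5 * R + 2 * C + 4 * δ + 1)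
    fun M => ⟨M, fun n hn => ⟨by linarith [hk n], by linarith [hfellow M n hn]⟩⟩
  simp only [stabEndpointPair_inv, mem_stabEndpointPair_iff hγ] at hg
  -- The common translate has the repelling point of `γ` as its own.
  have hrep : g • attractingPoint hγ.inv = attractingPoint hγ.inv := by
    refine boundaryMk_eq_iff.2 (GromovAsymptotic.of_unbounded hδ
      (hγ.inv.convergesAtInfinity.smul g) hγ.inv.convergesAtInfinity p fun b => ?_)
    obtain ⟨N, hN⟩ := hγ.inv.exists_lt_dist (b + R + δ)
    obtain ⟨n, hn, -, hn2⟩ := hg N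
    rw [mul_smul, inv_smul_eq_iff] at hn2
    have hasy : GromovAsymptotic (fun j : ℕ => k n • γ⁻¹ ^ j • p)
      (fun j : ℕ => g • γ⁻¹ ^ j • p) := boundaryMk_eq_iff.1 hn2
    obtain ⟨J, hJ⟩ := hturn n
    obtain ⟨J', hJ'⟩ := hasy.eventually_le hδ ⟨J, fun j hj => (hJ j hj).1⟩
    have h1 := hN (a n) (by rw [abs_of_nonneg (by omega)]; have := ha n; omega)
    rw [zpow_natCast] at h1
    exact ⟨J', a n, by linarith [hJ' J' le_rfl]⟩
  have hatt := hw.inv.smul_repelling_of_fix hγ.inv hrep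
  rw [attractingPoint_inv_inv hγ] at hatt
  obtain ⟨N, hN⟩ := hβ.exists_lt_dist (B + R + δ + 1)
  obtain ⟨n, hn, hn1, -⟩ := hg N
  rw [mul_smul, inv_smul_eq_iff, hatt] at hn1
  have hasy : GromovAsymptotic (fun j : ℕ => k n • γ ^ j • p) (fun j : ℕ => γ ^ j • p) :=
    boundaryMk_eq_iff.1 hn1
  obtain ⟨J, hJ⟩ := hturn n
  obtain ⟨J', hJ'⟩ := hasy.eventually_le hδ ⟨J, fun j hj => (hJ j hj).2⟩
  have h1 := hN (-(a n : ℤ)) (by rw [abs_neg, abs_of_nonneg (by omega)]; have := ha n; omega)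
  have h2 := hB J' (-(a n : ℤ))
  have h3 := hJ' J' le_rfl
  simp only [zpow_neg, zpow_natCast] at h1 h2
  linarith

theorem IsWWPD.exists_not_follows (hw : IsWWPD X γ) (hγ : IsLoxodromicAt γ p) {α : Γ}
    (hα : α ∉ stabEndpoints X γ) :
    ∃ A : ℕ, ∀ a ≥ A, ¬ Follows p (γ ^ a) (γ ^ a * α * (γ ^ a)⁻¹ * α⁻¹) := by
  obtain ⟨δ, hδ⟩ := IsGromovHyperbolic.exists_delta (X := X)
  obtain ⟨B, hB⟩ := hw.exists_gromovProduct_conj_le hγ hα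
  have hβ : IsLoxodromicAt (α * γ * α⁻¹) p := (hγ.conj α).change_base p
  obtain ⟨C, hC, A, hA⟩ := exists_isPingPong hδ hγ hβ hB
  obtain ⟨Cγ, -, hCγ⟩ := hγ.exists_between hδ
  obtain ⟨R, hR⟩ := Follows.exists_turning (p := p) (γ := γ) hδ hC hCγ
  by_contra! hcon
  have key : ∀ n : ℕ, ∃ (a : ℕ) (k : Γ), n ≤ a ∧ dist p (k • p) ≤ R ∧ ∃ J : ℕ, ∀ j ≥ J,
      dist p (γ⁻¹ ^ a • p) - R ≤ gromovProduct p (k • γ⁻¹ ^ j • p) (γ⁻¹ ^ a • p) ∧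
      dist p (((α * γ * α⁻¹) ^ a)⁻¹ • p) - R ≤
        gromovProduct p (k • γ ^ j • p) (((α * γ * α⁻¹) ^ a)⁻¹ • p) := by
    intro n
    obtain ⟨a, ha, hf⟩ := hcon (max n A)
    have e : γ ^ a * α * (γ ^ a)⁻¹ * α⁻¹ =
        γ ^ a * (((α * γ * α⁻¹) ^ a)⁻¹ * γ ^ a) * (γ ^ a)⁻¹ := by
      rw [conj_pow]; group
    rw [e] at hf
    obtain ⟨k, hk, hJ⟩ := hR a _ (hA a ((le_max_right _ _).trans ha)) hf.of_conj
    exact ⟨a, k, (le_max_left _ _).trans ha, hk, hJ⟩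
  choose a k ha hk hturn using key
  exact hw.not_turning hγ hβ hB ha hk hturn

end Conclusion

end HyperbolicAction

open HyperbolicAction

theorem mainTheorem4 {Γ X : Type*} [Group Γ] [MetricSpace X]
    [HyperbolicAction.IsGeodesicSpace X] [HyperbolicAction.IsGromovHyperbolic X]
    [MulAction Γ X] [IsIsometricSMul Γ X]
    (hne : HyperbolicAction.IsNonelementary Γ X)
    (γ : Γ) (hγ : HyperbolicAction.IsWWPD X γ)
    (α : Γ) (hα : α ∉ HyperbolicAction.stabEndpoints X γ) :
    ∃ A : ℕ, 0 < A ∧ ∀ a : ℕ, A ≤ a → ∀ g₁ h₁ : Γ,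
      g₁ = γ ^ a → h₁ = γ ^ a * α * (γ ^ a)⁻¹ * α⁻¹ →
        HyperbolicAction.IsLoxodromic X h₁ ∧
        (¬ HyperbolicAction.Sim X g₁ h₁ ∧ ¬ HyperbolicAction.Sim X g₁ h₁⁻¹) ∧
        HyperbolicAction.FreelyGenerateSchottky X g₁ h₁ := by
  obtain ⟨p, hp⟩ := hγ.exists_isLoxodromicAt
  obtain ⟨δ, hδ⟩ := IsGromovHyperbolic.exists_delta (X := X)
  obtain ⟨B, hB⟩ := hγ.exists_gromovProduct_conj_le hp hα
  have hβ : IsLoxodromicAt (α * γ * α⁻¹) p := (hp.conj α).change_base p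
  obtain ⟨C, hC, A₁, hA₁⟩ := exists_isPingPong hδ hp hβ hB
  obtain ⟨A₂, hA₂⟩ := hγ.exists_not_follows hp hα
  obtain ⟨A₃, hA₃⟩ := hγ.exists_not_follows hp (α := α⁻¹) (by rwa [inv_mem_iff])
  refine ⟨max 1 (max A₁ (max A₂ A₃)), by positivity, ?_⟩
  rintro a ha _ _ rfl rfl
  simp only [max_le_iff] at ha
  obtain ⟨-, ha₁, ha₂, ha₃⟩ := ha
  have hpp := hA₁ a ha₁
  have e : γ ^ a * α * (γ ^ a)⁻¹ * α⁻¹ = γ ^ a * ((α * γ * α⁻¹) ^ a)⁻¹ := by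
    rw [conj_pow]; group
  refine ⟨⟨γ ^ a • p, ?_⟩, ⟨fun hs => hA₂ a ha₂ (hs.follows p), fun hs => ?_⟩, ?_⟩
  · -- Conjugating `h₁` by `γ ^ (-a)` gives `(β ^ a)⁻¹ * γ ^ a`.
    have := (hpp.isLoxodromicAt hδ hC).conj (γ ^ a)
    rwa [← mul_assoc, mul_inv_cancel_right, ← e] at this
  · -- The inverse is the conjugate by `α` of the same commutator formed with `α⁻¹`.
    have e' : (γ ^ a * α * (γ ^ a)⁻¹ * α⁻¹)⁻¹ =
        α * (γ ^ a * α⁻¹ * (γ ^ a)⁻¹ * α⁻¹⁻¹) * α⁻¹ := by group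
    rw [e'] at hs
    exact hA₃ a ha₃ (hs.follows p).of_conj
  · rw [e]
    exact hpp.freelyGenerateSchottky hδ hC
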